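/- Let $\mathbb{K}$ be a field of characteristic zero, let $V$ be a three-dimensional $\mathbb{K}$-vector space, and let $\mathscr{A}$ be a $3$-arrangement in $V$, that is, a finite set of $n=|\mathscr{A}|$ two-dimensional linear subspaces of $V$. Let $x_1,x_2,x_3$ be a basis of $V^{*}$, let $S=\mathrm{Sym}(V^{*})=\mathbb{K}[x_1,x_2,x_3]$, for each $H\in\mathscr{A}$ let $\alpha_H\in V^{*}$ be a linear form with kernel $H$, and let $Q=\prod_{H\in\mathscr{A}}\alpha_H\in S$. For an integer $m\ge 0$ let $D^{(m)}(S)=\sum_{|\bm a|=m}S\,\partial^{\bm a}$ be the $S$-module of differential operators on $S$ generated by the partial derivatives $\partial^{\bm a}=\partial_1^{a_1}\partial_2^{a_2}\partial_3^{a_3}$ of order $m$, and let $$D^{(m)}(\mathscr{A},V)=\{\theta\in D^{(m)}(S)\mid \theta(QS)\subseteq QS\}.$$ Call $\mathscr{A}$ $m$-free if the $S$-module $D^{(m)}(\mathscr{A},V)$ is generated by $\binom{m+2}{m}$ elements that are linearly independent over $S$ (so that it is a free $S$-module), and call $\mathscr{A}$ essential if $\bigcap_{H\in\mathscr{A}}H=\{0\}$.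 Then: 1. If $\mathscr{A}$ is essential, then $\mathscr{A}$ is $m$-free for all integers $m\ge 0$ with $m\ge n-2$. 2. If $\mathscr{A}$ is not essential, then $\mathscr{A}$ is $m$-free for all integers $m\ge 0$. 3. In particular every $3$-arrangement $\mathscr{A}$ is $m$-free for all sufficiently large $m$, which answers Holm's question affirmatively for $\ell=3$. -/

import Mathlib

/-- A (central hyperplane) arrangement in `V`: a finite set of linear hyperplanes of `V`. -/
structure CentralArrangement (K V : Type*) [Field K] [AddCommGroup V] [Module K V] where
  hyperplanes : Finset (Submodule K V)
  isCoatom : ∀ H ∈ hyperplanes, IsCoatom H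

namespace CentralArrangement

/-- Every hyperplane is the kernel of a linear form. -/
theorem exists_ker_eq {K V : Type*} [Field K] [AddCommGroup V] [Module K V]
    {H : Submodule K V} (hH : IsCoatom H) : ∃ α : Module.Dual K V, LinearMap.ker α = H := by
  obtain ⟨α, hα, hle⟩ := Submodule.exists_le_ker_of_lt_top H hH.lt_top
  refine ⟨α, ?_⟩
  rcases hH.le_iff.mp hle with h | h
  · exact absurd (LinearMap.ker_eq_top.mp h) hα
  · exact h

open Classical in
/-- A linear form `α_H` whose kernel is the hyperplane `H` (and `0` if `H` is not the kernel of a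
linear form). It is unique up to a nonzero scalar. -/
noncomputable def linearForm {K V : Type*} [Field K] [AddCommGroup V] [Module K V]
    (H : Submodule K V) : Module.Dual K V :=
  if h : ∃ α : Module.Dual K V, LinearMap.ker α = H then h.choose else 0

theorem ker_linearForm {K V : Type*} [Field K] [AddCommGroup V] [Module K V]
    {H : Submodule K V} (hH : IsCoatom H) : LinearMap.ker (linearForm H) = H := by
  have h := exists_ker_eq hH
  rw [linearForm, dif_pos h]
  exact h.choose_spec

/-- The linear form `α` on `V` as an element of `S = K[x₁, …, x_ℓ]`, where `x₁, …, x_ℓ` is the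
dual basis of `b`: it is `∑ i, α (b i) x_i`. -/
noncomputable def formToPoly {K V : Type*} [Field K] [AddCommGroup V] [Module K V] {l : ℕ}
    (b : Module.Basis (Fin l) K V) (α : Module.Dual K V) : MvPolynomial (Fin l) K :=
  ∑ i, MvPolynomial.C (α (b i)) * MvPolynomial.X i

/-- The defining polynomial `Q = ∏ H ∈ A, α_H`. -/
noncomputable def definingPoly {K V : Type*} [Field K] [AddCommGroup V] [Module K V] {l : ℕ}
    (b : Module.Basis (Fin l) K V) (A : CentralArrangement K V) : MvPolynomial (Fin l) K :=
  ∏ H ∈ A.hyperplanes, formToPoly b (linearForm H)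

/-- The operator `∂^a = ∂₁^{a₁} ⋯ ∂_ℓ^{a_ℓ}` on `S`. -/
noncomputable def partialOp (K : Type*) [Field K] {l : ℕ} (a : Fin l → ℕ) :
    Module.End K (MvPolynomial (Fin l) K) :=
  (List.ofFn fun i : Fin l =>
    ((MvPolynomial.pderiv (R := K) i : Derivation K (MvPolynomial (Fin l) K)
      (MvPolynomial (Fin l) K)) : Module.End K (MvPolynomial (Fin l) K)) ^ a i).prod

/-- `D^{(m)}(S)`: the `S`-module generated by the `∂^a` with `|a| = m`, inside the `S`-module of
`K`-linear endomorphisms of `S` (where `(f • θ) g = f * θ g`). -/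
noncomputable def diffOps (K : Type*) [Field K] (l m : ℕ) :
    Submodule (MvPolynomial (Fin l) K) (Module.End K (MvPolynomial (Fin l) K)) :=
  Submodule.span (MvPolynomial (Fin l) K) {θ | ∃ a : Fin l → ℕ, ∑ i, a i = m ∧ θ = partialOp K a}

/-- `D^{(m)}(A, V)`: the `S`-module of all `θ ∈ D^{(m)}(S)` with `θ (Q S) ⊆ Q S`. -/
noncomputable def diffOpsOf {K V : Type*} [Field K] [AddCommGroup V] [Module K V] {l : ℕ}
    (b : Module.Basis (Fin l) K V) (A : CentralArrangement K V) (m : ℕ) :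
    Submodule (MvPolynomial (Fin l) K) (Module.End K (MvPolynomial (Fin l) K)) where
  carrier := {θ | θ ∈ diffOps K l m ∧
    ∀ g ∈ Ideal.span {definingPoly b A}, θ g ∈ Ideal.span {definingPoly b A}}
  zero_mem' := ⟨Submodule.zero_mem _, fun _ _ => by simp⟩
  add_mem' := fun hθ hη => ⟨Submodule.add_mem _ hθ.1 hη.1, fun g hg => by
    rw [LinearMap.add_apply]
    exact Ideal.add_mem _ (hθ.2 g hg) (hη.2 g hg)⟩
  smul_mem' := fun f _ hθ => ⟨Submodule.smul_mem _ f hθ.1, fun g hg => by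
    rw [LinearMap.smul_apply, smul_eq_mul]
    exact Ideal.mul_mem_left _ f (hθ.2 g hg)⟩

/-- `A` is `m`-free: the `S`-module `D^{(m)}(A, V)` is generated by
`s_m(ℓ) = (m + ℓ - 1).choose m` elements that are linearly independent over `S`. -/
def IsMFree {K V : Type*} [Field K] [AddCommGroup V] [Module K V] {l : ℕ}
    (b : Module.Basis (Fin l) K V) (A : CentralArrangement K V) (m : ℕ) : Prop :=
  ∃ θ : Fin ((m + l - 1).choose m) → Module.End K (MvPolynomial (Fin l) K),
    LinearIndependent (MvPolynomial (Fin l) K) θ ∧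
    Submodule.span (MvPolynomial (Fin l) K) (Set.range θ) = diffOpsOf b A m

/-- `A` is essential: the intersection of all its hyperplanes is `{0}`. -/
def IsEssential {K V : Type*} [Field K] [AddCommGroup V] [Module K V]
    (A : CentralArrangement K V) : Prop :=
  sInf (A.hyperplanes : Set (Submodule K V)) = ⊥

end CentralArrangement

/-! In characteristic zero an operator of order `m` is determined by its restriction to the space
`S_m` of forms of degree `m`, and every `K`-linear map `S_m → S` is such a restriction. The operator
preserves `Q S` exactly when its restriction `φ` is admissible: for every defining form `α`, `α ∣ g`
implies `α ∣ φ g` (`preserves_span_prod_iff`). Freeness thus becomes a statement about `admissible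
(Forms K m) A`, and there `S_m` may be cut into pieces. A direct sum decomposition compatible with
divisibility by each `α` splits the admissible maps into a product
(`free_admissible_of_decomposition`), and a common factor of a piece can be removed
(`free_admissible_mul`).

For `m ≥ n - 2`, pad the arrangement to exactly `m + 2` lines of the projective plane. For an
intersection point `X` on `k` of these lines, let `P_X` be the product of the lines missing `X`.
Then `S_m = ⨁ P_X S_{k-2}`. The dimensions agree because counting pairs of lines by their
intersection point gives `∑ k.choose 2 = (m + 2).choose 2`. Independence and compatibility both
follow from `dvd_of_dvd_sum_points`, a computation modulo the `(α, β)`-primary ideal `(α, β^(k-1))`.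
On the block of `X`, only the lines through `X` still impose conditions on `S_{k-2}`.

It remains to treat lines through one point, which is also the non-essential case. If the lines lie
in the pencil of `a, b` and `z` is a third coordinate, then `S_d` is the sum of the pieces `z^i K[a,
b]_{d-i}`. On binary forms of degree `j` an explicit basis exists, built from the products of all
but one of `j + 1` forms (`free_admissible_span_pow`). -/

open MvPolynomial

namespace CentralArrangement

variable {K : Type*} [Field K]

/-! ### Homogeneous forms, their dimension, and linear coordinates -/

/-- The forms of degree `d` in three variables. -/
abbrev Forms (K : Type*) [Field K] (d : ℕ) : Submodule K (MvPolynomial (Fin 3) K) :=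
  homogeneousSubmodule (Fin 3) K d

attribute [local instance] MvPolynomial.gradedAlgebra

theorem decompose_eq_homogeneousComponent {σ : Type*} (f : MvPolynomial σ K) (i : ℕ) :
    (DirectSum.decompose (homogeneousSubmodule σ K) f i : MvPolynomial σ K) =
      homogeneousComponent i f :=
  decomposition.decompose'_apply f i

theorem homogeneousComponent_add_mul {σ : Type*} {f g : MvPolynomial σ K} {n : ℕ}
    (hf : f.IsHomogeneous n) (k : ℕ) :
    homogeneousComponent (k + n) (g * f) = homogeneousComponent k g * f := by
  have h := DirectSum.coe_decompose_mul_add_of_right_mem (homogeneousSubmodule σ K) (i := k)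
    (a := g) ((mem_homogeneousSubmodule n f).2 hf)
  simpa only [decompose_eq_homogeneousComponent] using h

theorem homogeneousComponent_mul_of_lt {σ : Type*} {f g : MvPolynomial σ K} {n k : ℕ}
    (hf : f.IsHomogeneous n) (hk : k < n) : homogeneousComponent k (g * f) = 0 := by
  have h := DirectSum.coe_decompose_mul_of_right_mem_of_not_le (homogeneousSubmodule σ K)
    (a := g) ((mem_homogeneousSubmodule n f).2 hf) (not_le.2 hk)
  simpa only [decompose_eq_homogeneousComponent] using h

theorem eq_zero_of_dvd_of_lt {σ : Type*} {f p : MvPolynomial σ K} {d e : ℕ}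
    (hf : f.IsHomogeneous d) (hp : p.IsHomogeneous e) (hde : d < e) (h : p ∣ f) : f = 0 := by
  obtain ⟨q, rfl⟩ := h
  rw [← homogeneousComponent_eq_self hf, mul_comm, homogeneousComponent_mul_of_lt hp hde]

theorem exists_smul_of_dvd {σ : Type*} {α β : MvPolynomial σ K} {d : ℕ} (hα : α.IsHomogeneous d)
    (hβ : β.IsHomogeneous d) (h : α ∣ β) : ∃ c : K, β = c • α := by
  obtain ⟨q, rfl⟩ := h
  refine ⟨coeff 0 q, ?_⟩
  have h := homogeneousComponent_add_mul hα (g := q) 0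
  rw [zero_add, mul_comm, homogeneousComponent_eq_self hβ, homogeneousComponent_zero] at h
  rw [h, smul_eq_C_mul]

theorem isHomogeneous_of_mul {σ : Type*} {p q : MvPolynomial σ K} {d e : ℕ}
    (hp : p.IsHomogeneous e) (hp0 : p ≠ 0) (h : (p * q).IsHomogeneous (d + e)) :
    q.IsHomogeneous d := by
  have h' := homogeneousComponent_add_mul hp (g := q) d
  rw [mul_comm q, homogeneousComponent_eq_self h, mul_comm] at h'
  rw [mul_right_cancel₀ hp0 h']
  exact homogeneousComponent_isHomogeneous _ _

theorem prime_of_isHomogeneous_one {σ : Type*} {α : MvPolynomial σ K} (hα : α.IsHomogeneous 1)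
    (h0 : α ≠ 0) : Prime α := by
  refine Irreducible.prime (irreducible_of_totalDegree_eq_one (hα.totalDegree h0) fun x hx => ?_)
  refine isUnit_iff_ne_zero.2 ?_
  rintro rfl
  exact h0 (by ext i; simpa using hx i)

/-- The monomials of degree `d` form a basis of the forms of degree `d`. -/
noncomputable def formsBasis (K : Type*) [Field K] (d : ℕ) :
    Module.Basis {a : Fin 3 →₀ ℕ | a.degree = d} K (Forms K d) :=
  .mk (v := fun a => ⟨monomial (a : Fin 3 →₀ ℕ) 1, isHomogeneous_monomial 1 a.2⟩)
    (by
      refine LinearIndependent.of_comp (Forms K d).subtype ?_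
      have := (basisMonomials (Fin 3) K).linearIndependent.comp
        (Subtype.val : {a : Fin 3 →₀ ℕ | a.degree = d} → _) Subtype.val_injective
      exact this)
    (by
      rintro ⟨f, hf⟩ -
      have h : (⟨f, hf⟩ : Forms K d) = ∑ a ∈ f.support.attach, coeff a.1 f •
          (⟨monomial a.1 1, isHomogeneous_monomial 1
            (by by_contra h; exact mem_support_iff.1 a.2 (hf.coeff_eq_zero h))⟩ : Forms K d) := by
        ext1
        simp only [AddSubmonoidClass.coe_finsetSum, Submodule.coe_smul, smul_monomial,
          smul_eq_mul, mul_one]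
        rw [Finset.sum_attach f.support fun a => monomial a (coeff a f)]
        exact f.as_sum
      rw [h]
      refine Submodule.sum_mem _ fun a _ => Submodule.smul_mem _ _ (Submodule.subset_span ?_)
      exact ⟨⟨a.1, by by_contra h; exact mem_support_iff.1 a.2 (hf.coeff_eq_zero h)⟩, rfl⟩)

theorem formsBasis_apply (d : ℕ) (a : {a : Fin 3 →₀ ℕ | a.degree = d}) :
    (formsBasis K d a : MvPolynomial (Fin 3) K) = monomial (a : Fin 3 →₀ ℕ) 1 := by
  rw [formsBasis, Module.Basis.mk_apply]

theorem card_degree_eq (d : ℕ) :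
    Nat.card {a : Fin 3 →₀ ℕ | a.degree = d} = (d + 2).choose d := by
  classical
  have e : Sym (Fin 3) d ≃ {a : Fin 3 →₀ ℕ | a.degree = d} :=
    (Sym.equivNatSum (Fin 3) d).trans (Equiv.subtypeEquivRight fun a => by
      simp [Finsupp.degree_apply, Finsupp.sum])
  rw [← Nat.card_congr e, Nat.card_eq_fintype_card, Sym.card_sym_eq_choose, Fintype.card_fin]
  congr 1
  omega

instance (d : ℕ) : Finite {a : Fin 3 →₀ ℕ | a.degree = d} :=
  Nat.finite_of_card_ne_zero (by
    rw [card_degree_eq]; exact (Nat.choose_pos (by omega)).ne')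

instance (d : ℕ) : Module.Finite K (Forms K d) := Module.Finite.of_basis (formsBasis K d)

theorem finrank_forms (d : ℕ) : Module.finrank K (Forms K d) = (d + 2).choose 2 := by
  rw [Module.finrank_eq_nat_card_basis (formsBasis K d), card_degree_eq,
    Nat.choose_symm_add]

/-- Two independent linear forms are part of a system of linear coordinates. -/
theorem exists_algEquiv {a b : MvPolynomial (Fin 3) K} (ha : a.IsHomogeneous 1)
    (hb : b.IsHomogeneous 1) (hab : LinearIndependent K ![a, b]) :
    ∃ σ : MvPolynomial (Fin 3) K ≃ₐ[K] MvPolynomial (Fin 3) K, σ (X 0) = a ∧ σ (X 1) = b ∧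
      (∀ d f, f.IsHomogeneous d → (σ f).IsHomogeneous d) ∧
      (∀ d f, f.IsHomogeneous d → (σ.symm f).IsHomogeneous d) := by
  have h3 : Module.finrank K (Forms K 1) = 3 := by rw [finrank_forms]; rfl
  have hle : Submodule.span K (Set.range ![a, b]) ≤ Forms K 1 := by
    rw [Submodule.span_le]
    rintro _ ⟨i, rfl⟩
    fin_cases i <;> assumption
  have hlt : Submodule.span K (Set.range ![a, b]) < Forms K 1 := by
    refine lt_of_le_of_ne hle fun h => ?_
    have := finrank_span_eq_card hab
    rw [h, h3] at this
    simp at this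
  obtain ⟨z, hz, hz'⟩ := Set.exists_of_ssubset hlt
  have hli := (linearIndependent_finSnoc (x := z)).2 ⟨hab, hz'⟩
  set v : Fin 3 → MvPolynomial (Fin 3) K := Fin.snoc ![a, b] z with hv
  have hv1 : ∀ i, (v i).IsHomogeneous 1 := by
    intro i
    fin_cases i
    · exact ha
    · exact hb
    · exact hz
  have hspan : Submodule.span K (Set.range v) = Forms K 1 := by
    refine Submodule.eq_of_le_of_finrank_eq ?_ ?_
    · rw [Submodule.span_le]
      rintro _ ⟨i, rfl⟩
      exact hv1 i
    · rw [finrank_span_eq_card hli, h3]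
      rfl
  have hX : ∀ j : Fin 3, ∃ c : Fin 3 → K, ∑ i, c i • v i = X j := fun j =>
    (Submodule.mem_span_range_iff_exists_fun K).1 (hspan ▸ isHomogeneous_X K j)
  choose c hc using hX
  set s : MvPolynomial (Fin 3) K →ₐ[K] MvPolynomial (Fin 3) K := aeval v with hs
  set t : MvPolynomial (Fin 3) K →ₐ[K] MvPolynomial (Fin 3) K :=
    aeval (fun j => ∑ i, c j i • (X i : MvPolynomial (Fin 3) K)) with ht
  have hst : s.comp t = AlgHom.id K _ := by
    refine algHom_ext fun j => ?_
    simp [hs, ht, hc]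
  have hst' : ∀ f, s (t f) = f := fun f => DFunLike.congr_fun hst f
  have ht1 : ∀ d f, f.IsHomogeneous d → (t f).IsHomogeneous d := fun d f hf => by
    have := hf.aeval (fun j => ∑ i, c j i • (X i : MvPolynomial (Fin 3) K)) (n := 1) fun j =>
      IsHomogeneous.sum _ _ _ fun i _ => by
        rw [smul_eq_C_mul]; exact (isHomogeneous_X K i).C_mul _
    rwa [one_mul] at this
  -- The identity `s ∘ t = id` makes `t` injective on linear forms, hence surjective there by finite
  -- dimension, so the one-sided inverse is two-sided.
  have hts : t.comp s = AlgHom.id K _ := by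
    refine algHom_ext fun j => ?_
    have hsurj : Function.Surjective (t.toLinearMap.restrict (p := Forms K 1) (q := Forms K 1)
        fun f hf => ht1 1 f hf) :=
      LinearMap.surjective_of_injective fun f g h => Subtype.ext <| by
        have := congrArg (fun x : Forms K 1 => s x) h
        change s (t f) = s (t g) at this
        rwa [hst', hst'] at this
    obtain ⟨g, hg⟩ := hsurj ⟨X j, isHomogeneous_X K j⟩
    have hg' : t g = X j := congrArg Subtype.val hg
    rw [AlgHom.comp_apply, ← hg', hst', hg', AlgHom.id_apply]
  refine ⟨AlgEquiv.ofAlgHom s t hst hts, ?_, ?_, ?_, ?_⟩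
  · exact aeval_X _ _
  · exact aeval_X _ _
  · intro d f hf
    have := hf.aeval v hv1
    rwa [one_mul] at this
  · exact ht1

/-! ### Admissible maps: direct sums and common factors -/

/-- The `K`-linear maps `φ : B → S` such that every `α ∈ A` dividing `g ∈ B` divides `φ g`. -/
noncomputable def admissible {σ : Type*} (B : Submodule K (MvPolynomial σ K))
    (A : Finset (MvPolynomial σ K)) : Submodule (MvPolynomial σ K) (B →ₗ[K] MvPolynomial σ K) where
  carrier := {φ | ∀ α ∈ A, ∀ g : B, α ∣ (g : MvPolynomial σ K) → α ∣ φ g}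
  zero_mem' := fun _ _ _ _ => by simp
  add_mem' := fun h₁ h₂ α hα g hg => by
    rw [LinearMap.add_apply]
    exact dvd_add (h₁ α hα g hg) (h₂ α hα g hg)
  smul_mem' := fun f _ h α hα g hg => by
    rw [LinearMap.smul_apply, smul_eq_mul]
    exact Dvd.dvd.mul_left (h α hα g hg) f

/-- A linear map all of whose values are divisible by `p ≠ 0` can be divided by `p`. -/
theorem exists_linearMap_mul_eq {R W : Type*} [CommRing R] [IsDomain R] [Algebra K R]
    [AddCommGroup W] [Module K W] (φ : W →ₗ[K] R) {p : R} (hp : p ≠ 0) (h : ∀ w, p ∣ φ w) :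
    ∃ ψ : W →ₗ[K] R, ∀ w, φ w = p * ψ w := by
  choose ψ hψ using h
  refine ⟨{ toFun := ψ, map_add' := fun x y => ?_, map_smul' := fun c x => ?_ }, hψ⟩
  · apply mul_left_cancel₀ hp
    rw [mul_add, ← hψ, ← hψ, ← hψ, map_add]
  · apply mul_left_cancel₀ hp
    rw [RingHom.id_apply, mul_smul_comm, ← hψ, ← hψ, map_smul]

/-- If `B` is the direct sum of the `C i`, compatibly with divisibility by the elements of `A`,
then freeness for all the `C i` implies freeness for `B`. -/
theorem free_admissible_of_decomposition {σ ι : Type*} [Fintype ι] [DecidableEq ι]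
    {B : Submodule K (MvPolynomial σ K)} {A : Finset (MvPolynomial σ K)}
    (C : ι → Submodule K (MvPolynomial σ K)) (hle : ∀ i, C i ≤ B)
    (hinj : ∀ g : ∀ i, C i, ∑ i, (g i : MvPolynomial σ K) = 0 → g = 0)
    (hsurj : ∀ f ∈ B, ∃ g : ∀ i, C i, ∑ i, (g i : MvPolynomial σ K) = f)
    (hdvd : ∀ α ∈ A, ∀ g : ∀ i, C i, α ∣ ∑ i, (g i : MvPolynomial σ K) →
      ∀ i, α ∣ (g i : MvPolynomial σ K))
    (hfree : ∀ i, Module.Free (MvPolynomial σ K) (admissible (C i) A)) :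
    Module.Free (MvPolynomial σ K) (admissible B A) := by
  let s : (∀ i, C i) →ₗ[K] B := LinearMap.lsum K (fun i => C i) K fun i => Submodule.inclusion (hle i)
  have hs : ∀ g, (s g : MvPolynomial σ K) = ∑ i, (g i : MvPolynomial σ K) := fun g => by
    simp [s, LinearMap.lsum_apply]
  let e : (∀ i, C i) ≃ₗ[K] B := LinearEquiv.ofBijective s
    ⟨(injective_iff_map_eq_zero s).2 fun g hg => hinj g (by rw [← hs, hg]; rfl),
      fun f => (hsurj f f.2).imp fun g hg => Subtype.ext (by rw [hs, hg])⟩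
  have he : ∀ g, (e g : MvPolynomial σ K) = ∑ i, (g i : MvPolynomial σ K) := hs
  have hes : ∀ i (g : C i), e (Pi.single i g) = Submodule.inclusion (hle i) g := fun i g => by
    ext1
    rw [he, Finset.sum_eq_single i]
    · simp
    · intro j _ hj
      simp [Pi.single_eq_of_ne hj]
    · simp
  let r : admissible B A →ₗ[MvPolynomial σ K] ∀ i, admissible (C i) A :=
    { toFun := fun φ i => ⟨φ.1 ∘ₗ Submodule.inclusion (hle i), fun α hα g hg =>
        φ.2 α hα _ (by simpa using hg)⟩
      map_add' := fun _ _ => rfl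
      map_smul' := fun _ _ => rfl }
  have hr : Function.Bijective r := by
    constructor
    · rw [injective_iff_map_eq_zero]
      intro φ hφ
      have h0 : ∀ i (g : C i), φ.1 (Submodule.inclusion (hle i) g) = 0 := fun i g =>
        DFunLike.congr_fun (congrArg Subtype.val (congrFun hφ i)) g
      ext1
      refine LinearMap.ext fun f => ?_
      obtain ⟨g, rfl⟩ := e.surjective f
      rw [← Finset.univ_sum_single g, map_sum, map_sum]
      exact Finset.sum_eq_zero fun i _ => by rw [hes, h0]
    · intro ψ
      refine ⟨⟨(LinearMap.lsum K (fun i => C i) K fun i => (ψ i).1) ∘ₗ e.symm.toLinearMap, ?_⟩, ?_⟩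
      -- Gluing maps on the summands keeps admissibility because divisibility of a sum by `α` passes
      -- to each summand.
      · intro α hα f hf
        obtain ⟨g, rfl⟩ := e.surjective f
        rw [he] at hf
        have := hdvd α hα g hf
        simp only [LinearMap.comp_apply, LinearEquiv.coe_coe, LinearEquiv.symm_apply_apply,
          LinearMap.lsum_apply, LinearMap.sum_apply, LinearMap.proj_apply]
        exact Finset.dvd_sum fun i _ => (ψ i).2 α hα _ (this i)
      · funext i
        ext1
        refine LinearMap.ext fun g => ?_
        change (LinearMap.lsum K (fun i => C i) K fun i => (ψ i).1)
          (e.symm (Submodule.inclusion (hle i) g)) = (ψ i).1 g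
        rw [← hes, LinearEquiv.symm_apply_apply, LinearMap.lsum_piSingle]
  exact Module.Free.of_equiv (LinearEquiv.ofBijective r hr).symm

theorem isRelPrime_of_prime {R : Type*} [CommRing R] [IsDomain R] {p q : R} (hp : Prime p)
    (h : ¬ p ∣ q) : IsRelPrime p q :=
  (hp.irreducible.isRelPrime_iff_not_dvd).2 h

/-- Multiplication by `p` identifies the admissible maps on `B` with those on `p B`; elements
of `A` dividing `p` impose no condition on `B`. -/
theorem free_admissible_mul {σ : Type*} {B : Submodule K (MvPolynomial σ K)}
    {A A₂ : Finset (MvPolynomial σ K)} {p : MvPolynomial σ K} (hp : p ≠ 0)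
    (hprime : ∀ α ∈ A, Prime α) (hne : ∀ α ∈ A, ∀ β ∈ A, α ∣ β → α = β)
    (hA₂ : ∀ α, α ∈ A₂ ↔ α ∈ A ∧ ¬ α ∣ p)
    (hfree : Module.Free (MvPolynomial σ K) (admissible B A₂)) :
    Module.Free (MvPolynomial σ K) (admissible (B.map (LinearMap.mulLeft K p)) A) := by
  classical
  set A₁ := A.filter (· ∣ p)
  have hA : ∀ α, α ∈ A ↔ α ∈ A₁ ∨ α ∈ A₂ := fun α => by
    rw [Finset.mem_filter, hA₂, ← and_or_left, and_iff_left (em _)]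
  have h₁ : ∀ α ∈ A₁, α ∣ p := fun α hα => (Finset.mem_filter.1 hα).2
  have h₂ : ∀ α ∈ A₂, ¬ α ∣ p := fun α hα => ((hA₂ α).1 hα).2
  -- The forms dividing `p` divide every element of `p B`, so `q` divides every value of an
  -- admissible map. Dividing by `q` uses up exactly these conditions.
  set q : MvPolynomial σ K := ∏ α ∈ A₁, α with hq
  have hq0 : q ≠ 0 := Finset.prod_ne_zero_iff.2 fun α hα => (hprime α ((hA α).2 (Or.inl hα))).ne_zero
  let e : B ≃ₗ[K] B.map (LinearMap.mulLeft K p) :=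
    Submodule.equivMapOfInjective _ (fun _ _ h => mul_left_cancel₀ hp h) B
  have he : ∀ g : B, (e g : MvPolynomial σ K) = p * g := fun g => rfl
  let s : admissible B A₂ →ₗ[MvPolynomial σ K] admissible (B.map (LinearMap.mulLeft K p)) A :=
    { toFun := fun ψ => ⟨q • (ψ.1 ∘ₗ e.symm.toLinearMap), fun α hα g hg => by
        obtain ⟨g, rfl⟩ := e.surjective g
        rw [LinearMap.smul_apply, LinearMap.comp_apply, LinearEquiv.coe_coe,
          LinearEquiv.symm_apply_apply, smul_eq_mul]
        rcases (hA α).1 hα with h | h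
        · exact Dvd.dvd.mul_right (Finset.dvd_prod_of_mem _ h) _
        · rw [he] at hg
          exact Dvd.dvd.mul_left (ψ.2 α h g (((hprime α hα).dvd_or_dvd hg).resolve_left (h₂ α h))) _⟩
      map_add' := fun ψ₁ ψ₂ => Subtype.ext <| LinearMap.ext fun g => by
        simp [mul_add]
      map_smul' := fun f ψ => Subtype.ext <| LinearMap.ext fun g => by
        simp [mul_left_comm] }
  have hsa : ∀ ψ g, (s ψ).1 (e g) = q * ψ.1 g := fun ψ g => by
    change q * ψ.1 (e.symm (e g)) = _
    rw [LinearEquiv.symm_apply_apply]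
  have hs : Function.Bijective s := by
    constructor
    · rw [injective_iff_map_eq_zero]
      intro ψ hψ
      ext1
      refine LinearMap.ext fun g => ?_
      have := hsa ψ g
      rw [hψ] at this
      exact (mul_eq_zero.1 this.symm).resolve_left hq0
    · intro φ
      obtain ⟨ψ, hψ⟩ := exists_linearMap_mul_eq (φ.1 ∘ₗ e.toLinearMap) hq0 fun g => by
        refine Finset.prod_dvd_of_isRelPrime (fun α hα β hβ hαβ => ?_) fun α hα => ?_
        · exact isRelPrime_of_prime (hprime α ((hA α).2 (Or.inl hα))) fun h =>
            hαβ (hne α ((hA α).2 (Or.inl hα)) β ((hA β).2 (Or.inl hβ)) h)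
        · exact φ.2 α ((hA α).2 (Or.inl hα)) (e g) (Dvd.dvd.mul_right (h₁ α hα) _)
      refine ⟨⟨ψ, fun α hα g hg => ?_⟩, ?_⟩
      · have h := φ.2 α ((hA α).2 (Or.inr hα)) (e g) (Dvd.dvd.mul_left hg _)
        have h' : φ.1 (e g) = q * ψ g := hψ g
        rw [h'] at h
        refine ((hprime α ((hA α).2 (Or.inr hα))).dvd_or_dvd h).resolve_left fun h => ?_
        obtain ⟨β, hβ, hd⟩ := ((hprime α ((hA α).2 (Or.inr hα))).dvd_finsetProd_iff _).1 h
        exact h₂ α hα (hd.trans (h₁ β hβ))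
      · ext1
        refine LinearMap.ext fun g => ?_
        obtain ⟨g, rfl⟩ := e.surjective g
        rw [hsa]
        exact (hψ g).symm
  exact Module.Free.of_equiv (LinearEquiv.ofBijective s hs)

/-! ### Reduced sets of linear forms -/

/-- A finite set of pairwise non-proportional nonzero linear forms. -/
structure IsReducedForms {σ : Type*} (A : Finset (MvPolynomial σ K)) : Prop where
  homog : ∀ α ∈ A, α.IsHomogeneous 1
  ne_zero : ∀ α ∈ A, α ≠ 0
  eq_of_dvd : ∀ α ∈ A, ∀ β ∈ A, α ∣ β → α = β

namespace IsReducedForms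

variable {σ : Type*} {A : Finset (MvPolynomial σ K)}

theorem prime (hA : IsReducedForms A) {α : MvPolynomial σ K} (hα : α ∈ A) : Prime α :=
  prime_of_isHomogeneous_one (hA.homog α hα) (hA.ne_zero α hα)

theorem mono (hA : IsReducedForms A) {B : Finset (MvPolynomial σ K)} (h : B ⊆ A) :
    IsReducedForms B :=
  ⟨fun α hα => hA.homog α (h hα), fun α hα => hA.ne_zero α (h hα),
    fun α hα β hβ => hA.eq_of_dvd α (h hα) β (h hβ)⟩

theorem not_dvd_prod (hA : IsReducedForms A) {B : Finset (MvPolynomial σ K)} (hB : B ⊆ A)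
    {α : MvPolynomial σ K} (hα : α ∈ A) (hαB : α ∉ B) : ¬ α ∣ ∏ β ∈ B, β := fun h => by
  obtain ⟨β, hβ, hd⟩ := ((hA.prime hα).dvd_finsetProd_iff _).1 h
  exact hαB (hA.eq_of_dvd α hα β (hB hβ) hd ▸ hβ)

theorem prod_dvd (hA : IsReducedForms A) {f : MvPolynomial σ K} (h : ∀ α ∈ A, α ∣ f) :
    ∏ α ∈ A, α ∣ f :=
  Finset.prod_dvd_of_isRelPrime (fun α hα β hβ hαβ =>
    isRelPrime_of_prime (hA.prime hα) fun h => hαβ (hA.eq_of_dvd α hα β hβ h)) h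

theorem prod_ne_zero (hA : IsReducedForms A) : ∏ α ∈ A, α ≠ 0 :=
  Finset.prod_ne_zero_iff.2 hA.ne_zero

theorem isHomogeneous_prod (hA : IsReducedForms A) : (∏ α ∈ A, α).IsHomogeneous A.card := by
  have := IsHomogeneous.prod A (fun α => α) (fun _ => 1) hA.homog
  simpa using this

theorem eq_zero_of_forall_dvd (hA : IsReducedForms A) {f : MvPolynomial σ K} {d : ℕ}
    (hf : f.IsHomogeneous d) (hd : d < A.card) (h : ∀ α ∈ A, α ∣ f) : f = 0 :=
  eq_zero_of_dvd_of_lt hf hA.isHomogeneous_prod hd (hA.prod_dvd h)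

end IsReducedForms

/-! ### Forms in a pencil and their interpolation basis -/

section Pencil

variable {σ : Type*} {a b : MvPolynomial σ K}

theorem linearIndependent_of_not_dvd {α β : MvPolynomial σ K} (hα : α ≠ 0) (h : ¬ α ∣ β) :
    LinearIndependent K ![α, β] := by
  rw [LinearIndependent.pair_iff]
  intro s t hst
  have ht : t = 0 := by
    by_contra ht
    refine h ⟨C (-(t⁻¹ * s)), ?_⟩
    rw [mul_comm, ← smul_eq_C_mul, neg_smul, mul_smul, eq_neg_iff_add_eq_zero]
    have := congrArg (t⁻¹ • ·) hst
    simp only [smul_add, smul_zero, inv_smul_smul₀ ht] at this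
    rw [add_comm, this]
  subst ht
  simpa [hα] using hst

theorem not_dvd_of_linearIndependent {α β : MvPolynomial σ K} (hα : α.IsHomogeneous 1)
    (hβ : β.IsHomogeneous 1) (h : LinearIndependent K ![α, β]) : ¬ α ∣ β := fun hd => by
  obtain ⟨c, rfl⟩ := exists_smul_of_dvd hα hβ hd
  have := (LinearIndependent.pair_iff.1 h) c (-1) (by simp)
  simp at this

theorem dvd_symm_of_isHomogeneous_one {α β : MvPolynomial σ K} (hα : α.IsHomogeneous 1)
    (hβ : β.IsHomogeneous 1) (hβ0 : β ≠ 0) (h : α ∣ β) : β ∣ α := by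
  obtain ⟨c, rfl⟩ := exists_smul_of_dvd hα hβ h
  have hc : c ≠ 0 := by rintro rfl; simp at hβ0
  refine ⟨C c⁻¹, ?_⟩
  rw [mul_comm, ← smul_eq_C_mul, inv_smul_smul₀ hc]

theorem isHomogeneous_of_mem_span_pair {a b f : MvPolynomial σ K} (ha : a.IsHomogeneous 1)
    (hb : b.IsHomogeneous 1) (hf : f ∈ Submodule.span K {a, b}) : f.IsHomogeneous 1 := by
  have : Submodule.span K {a, b} ≤ homogeneousSubmodule σ K 1 := by
    rw [Submodule.span_le]
    rintro x (rfl | rfl)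
    · exact ha
    · exact hb
  exact this hf

theorem isHomogeneous_of_mem_span_pair_pow {a b f : MvPolynomial σ K} (ha : a.IsHomogeneous 1)
    (hb : b.IsHomogeneous 1) {j : ℕ} (hf : f ∈ Submodule.span K {a, b} ^ j) :
    f.IsHomogeneous j := by
  rw [← mem_homogeneousSubmodule, ← homogeneousSubmodule_one_pow]
  exact pow_le_pow_left' (show _ ≤ homogeneousSubmodule σ K 1 from
    fun g hg => isHomogeneous_of_mem_span_pair (f := g) ha hb hg) j hf

theorem span_pair_eq_of_linearIndependent {M : Type*} [AddCommGroup M] [Module K M]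
    {a b α β : M} (hα : α ∈ Submodule.span K {a, b})
    (hβ : β ∈ Submodule.span K {a, b}) (h : LinearIndependent K ![α, β]) :
    Submodule.span K {α, β} = Submodule.span K {a, b} := by
  classical
  have hfin : FiniteDimensional K (Submodule.span K {a, b}) :=
    FiniteDimensional.span_of_finite K (Set.toFinite _)
  refine Submodule.eq_of_le_of_finrank_le ?_ ?_
  · rw [Submodule.span_le]
    rintro x (rfl | rfl) <;> assumption
  · have h2 := finrank_span_eq_card h
    rw [Matrix.range_cons, Matrix.range_cons, Matrix.range_empty, Set.union_empty,
      Set.singleton_union] at h2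
    rw [h2, Fintype.card_fin]
    have := finrank_span_finset_le_card (R := K) ({a, b} : Finset M)
    rw [Finset.coe_pair] at this
    exact this.trans Finset.card_le_two

/-- Modulo a linear form in a pencil, all forms of degree `j` in the pencil are proportional. -/
theorem exists_dvd_sub_smul {α γ : MvPolynomial σ K} {j : ℕ} {f : MvPolynomial σ K}
    (hf : f ∈ Submodule.span K {α, γ} ^ j) : ∃ c : K, α ∣ f - c • γ ^ j := by
  induction j generalizing f with
  | zero =>
    rw [pow_zero, Submodule.mem_one] at hf
    obtain ⟨c, rfl⟩ := hf
    exact ⟨c, by rw [pow_zero, Algebra.algebraMap_eq_smul_one, sub_self]; exact dvd_zero _⟩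
  | succ j ih =>
    rw [pow_succ] at hf
    refine Submodule.mul_induction_on hf (fun m hm n hn => ?_) fun x y hx hy => ?_
    · obtain ⟨c, u, hu⟩ := ih hm
      obtain ⟨s, t, rfl⟩ := Submodule.mem_span_pair.1 hn
      rw [sub_eq_iff_eq_add] at hu
      refine ⟨c * t, u * (s • α + t • γ) + c • γ ^ j * C s, ?_⟩
      simp only [hu, smul_eq_C_mul, C_mul]
      ring
    · obtain ⟨c, hc⟩ := hx
      obtain ⟨d, hd⟩ := hy
      refine ⟨c + d, ?_⟩
      rw [add_smul, add_sub_add_comm]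
      exact dvd_add hc hd

/-- Modulo `α` the forms of degree `j` in the pencil are all multiples of one power `γ ^ j`, so any
of them that is nonzero modulo `α` can serve as the generator. -/
theorem exists_dvd_sub_smul_of_not_dvd (ha : a.IsHomogeneous 1) (hb : b.IsHomogeneous 1)
    (hab : LinearIndependent K ![a, b]) {α : MvPolynomial σ K}
    (hα : α ∈ Submodule.span K {a, b}) (hα0 : α ≠ 0) {j : ℕ} {f g : MvPolynomial σ K}
    (hf : f ∈ Submodule.span K {a, b} ^ j) (hg : g ∈ Submodule.span K {a, b} ^ j)
    (hd : ¬ α ∣ g) : ∃ c : K, α ∣ f - c • g := by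
  have hα1 := isHomogeneous_of_mem_span_pair ha hb hα
  obtain ⟨γ, hγ, hαγ⟩ : ∃ γ ∈ Submodule.span K {a, b}, ¬ α ∣ γ := by
    by_contra! h
    have h1 := dvd_symm_of_isHomogeneous_one hα1 ha (hab.ne_zero 0)
      (h a (Submodule.subset_span (by simp)))
    exact not_dvd_of_linearIndependent ha hb hab
      (h1.trans (h b (Submodule.subset_span (by simp))))
  rw [← span_pair_eq_of_linearIndependent hα hγ (linearIndependent_of_not_dvd hα0 hαγ)] at hf hg
  obtain ⟨c, hc⟩ := exists_dvd_sub_smul hf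
  obtain ⟨d, hd'⟩ := exists_dvd_sub_smul hg
  have hd0 : d ≠ 0 := by
    rintro rfl
    exact hd (by simpa using hd')
  refine ⟨c / d, ?_⟩
  have : f - (c / d) • g = (f - c • γ ^ j) - (c / d) • (g - d • γ ^ j) := by
    rw [smul_sub, smul_smul, div_mul_cancel₀ _ hd0]
    abel
  rw [this]
  exact dvd_sub hc (dvd_smul_of_dvd _ hd')

/-- A reduced set of forms can be enlarged to any cardinality by elements of a pencil. -/
theorem IsReducedForms.exists_superset [Infinite K] (ha : a.IsHomogeneous 1)
    (hb : b.IsHomogeneous 1) (hab : LinearIndependent K ![a, b])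
    {A : Finset (MvPolynomial σ K)} (hA : IsReducedForms A) {n : ℕ} (hn : A.card ≤ n) :
    ∃ B, A ⊆ B ∧ IsReducedForms B ∧ B.card = n ∧
      ∀ β ∈ B, β ∉ A → β ∈ Submodule.span K {a, b} := by
  classical
  induction n, hn using Nat.le_induction with
  | base => exact ⟨A, subset_rfl, hA, rfl, fun β h h' => absurd h h'⟩
  | succ n _ ih =>
    obtain ⟨B, hAB, hB, hc, hsp⟩ := ih
    -- A form dividing `a + t • b` for two values of `t` would divide both `a` and `b`. Each element
    -- of `B` therefore excludes at most one `t`.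
    have hfin : {t : K | ∃ α ∈ B, α ∣ a + t • b}.Finite := by
      have : {t : K | ∃ α ∈ B, α ∣ a + t • b} = ⋃ α ∈ B, {t : K | α ∣ a + t • b} := by
        ext t; simp
      rw [this]
      refine B.finite_toSet.biUnion fun α hα => Set.Subsingleton.finite fun t ht u hu => ?_
      by_contra htu
      have h1 : α ∣ (t - u) • b := by
        have := dvd_sub ht hu
        rwa [add_sub_add_left_eq_sub, ← sub_smul] at this
      have h2 : α ∣ b := by
        have := dvd_smul_of_dvd (t - u)⁻¹ h1
        rwa [inv_smul_smul₀ (sub_ne_zero.2 htu)] at this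
      have h3 : α ∣ a := by
        have := dvd_sub ht (dvd_smul_of_dvd t h2)
        rwa [add_sub_cancel_right] at this
      exact not_dvd_of_linearIndependent ha hb hab
        ((dvd_symm_of_isHomogeneous_one (hB.homog α hα) ha (hab.ne_zero 0) h3).trans h2)
    obtain ⟨t, ht⟩ := hfin.infinite_compl.nonempty
    have ht' : ∀ α ∈ B, ¬ α ∣ a + t • b := fun α hα h => ht ⟨α, hα, h⟩
    have hmem : a + t • b ∈ Submodule.span K {a, b} :=
      Submodule.mem_span_pair.2 ⟨1, t, by rw [one_smul]⟩
    have hh := isHomogeneous_of_mem_span_pair ha hb hmem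
    have hne : a + t • b ≠ 0 := fun h => by
      have := LinearIndependent.pair_iff.1 hab 1 t (by rwa [one_smul])
      simp at this
    have hnot : a + t • b ∉ B := fun h => ht' _ h dvd_rfl
    refine ⟨insert (a + t • b) B, hAB.trans (Finset.subset_insert _ _), ⟨?_, ?_, ?_⟩, ?_, ?_⟩
    · intro α hα
      rcases Finset.mem_insert.1 hα with rfl | h
      · exact hh
      · exact hB.homog α h
    · intro α hα
      rcases Finset.mem_insert.1 hα with rfl | h
      · exact hne
      · exact hB.ne_zero α h
    · intro α hα β hβ h
      rcases Finset.mem_insert.1 hα with rfl | hα <;> rcases Finset.mem_insert.1 hβ with rfl | hβ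
      · rfl
      · exact absurd (dvd_symm_of_isHomogeneous_one hh (hB.homog β hβ) (hB.ne_zero β hβ) h)
          (ht' β hβ)
      · exact absurd h (ht' α hα)
      · exact hB.eq_of_dvd α hα β hβ h
    · rw [Finset.card_insert_of_notMem hnot, hc]
    · intro β hβ hβA
      rcases Finset.mem_insert.1 hβ with rfl | h
      · exact hmem
      · exact hsp β h hβA

open Classical in
theorem prod_erase_mem_span_pow {Z : Finset (MvPolynomial σ K)} {j : ℕ} (hj : Z.card = j + 1)
    (hZs : ∀ α ∈ Z, α ∈ Submodule.span K {a, b}) {i : MvPolynomial σ K} (hi : i ∈ Z) :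
    ∏ α ∈ Z.erase i, α ∈ Submodule.span K {a, b} ^ j := by
  have hcard : (Z.erase i).card = j := by rw [Finset.card_erase_of_mem hi, hj]; rfl
  rw [← hcard]
  have : ∀ W : Finset (MvPolynomial σ K), W ⊆ Z →
      ∏ α ∈ W, α ∈ Submodule.span K {a, b} ^ W.card := by
    intro W
    induction W using Finset.induction_on with
    | empty => exact fun _ => ⟨1, by simp⟩
    | insert x W hx ih =>
      intro hW
      rw [Finset.prod_insert hx, Finset.card_insert_of_notMem hx, pow_succ']
      exact Submodule.mul_mem_mul (hZs x (hW (Finset.mem_insert_self _ _)))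
        (ih fun y hy => hW (Finset.mem_insert_of_mem hy))
  exact this _ (Finset.erase_subset _ _)

-- As in Lagrange interpolation, `i` divides every product in the sum except the one that omits it.
open Classical in
theorem coeff_eq_zero_of_dvd_sum {Z : Finset (MvPolynomial σ K)} (hZ : IsReducedForms Z)
    {c : Z → K} {i : Z}
    (h : (i : MvPolynomial σ K) ∣ ∑ l : Z, c l • ∏ α ∈ Z.erase (l : MvPolynomial σ K), α) :
    c i = 0 := by
  by_contra hc
  rw [← Finset.add_sum_erase _ _ (Finset.mem_univ i), dvd_add_left] at h
  · have h' := dvd_smul_of_dvd (c i)⁻¹ h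
    rw [inv_smul_smul₀ hc] at h'
    exact hZ.not_dvd_prod (Finset.erase_subset _ _) i.2 (Finset.notMem_erase _ _) h'
  · refine Finset.dvd_sum fun l hl => dvd_smul_of_dvd _ (Finset.dvd_prod_of_mem _ ?_)
    exact Finset.mem_erase.2 ⟨fun h => (Finset.ne_of_mem_erase hl) (Subtype.ext h.symm), i.2⟩

open Classical in
/-- The products of all but one of `j + 1` pairwise independent forms of a pencil form a basis of
the forms of degree `j` in the pencil. -/
theorem exists_basis_span_pow (ha : a.IsHomogeneous 1)
    (hb : b.IsHomogeneous 1) (hab : LinearIndependent K ![a, b])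
    {Z : Finset (MvPolynomial σ K)} (hZ : IsReducedForms Z)
    (hZs : ∀ α ∈ Z, α ∈ Submodule.span K {a, b}) {j : ℕ} (hj : Z.card = j + 1) :
    ∃ B : Module.Basis Z K (Submodule.span K {a, b} ^ j : Submodule K (MvPolynomial σ K)),
      ∀ i, (B i : MvPolynomial σ K) = ∏ α ∈ Z.erase (i : MvPolynomial σ K), α := by
  let v : Z → (Submodule.span K {a, b} ^ j : Submodule K (MvPolynomial σ K)) := fun i =>
    ⟨∏ α ∈ Z.erase (i : MvPolynomial σ K), α, prod_erase_mem_span_pow hj hZs i.2⟩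
  have hli : LinearIndependent K v := by
    rw [Fintype.linearIndependent_iff]
    intro c hc i
    refine coeff_eq_zero_of_dvd_sum hZ (i := i) ?_
    have := congrArg Subtype.val hc
    simp only [AddSubmonoidClass.coe_finsetSum, Submodule.coe_smul, v] at this
    rw [this]
    exact dvd_zero _
  have hspan : ⊤ ≤ Submodule.span K (Set.range v) := by
    rintro ⟨f, hf⟩ -
    have hex : ∀ i : Z, ∃ c : K, (i : MvPolynomial σ K) ∣
        f - c • ∏ α ∈ Z.erase (i : MvPolynomial σ K), α := fun i =>
      exists_dvd_sub_smul_of_not_dvd ha hb hab (hZs i i.2) (hZ.ne_zero i i.2) hf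
        (prod_erase_mem_span_pow hj hZs i.2)
        (hZ.not_dvd_prod (Finset.erase_subset _ _) i.2 (Finset.notMem_erase _ _))
    choose c hc using hex
    rw [Submodule.mem_span_range_iff_exists_fun]
    refine ⟨c, Subtype.ext ?_⟩
    simp only [AddSubmonoidClass.coe_finsetSum, Submodule.coe_smul, v]
    -- The interpolation error has degree `j` and is divisible by all `j + 1` elements of `Z`, so it
    -- vanishes.
    refine (sub_eq_zero.1 (hZ.eq_zero_of_forall_dvd (d := j) ?_ (by omega) ?_)).symm
    · refine (isHomogeneous_of_mem_span_pair_pow ha hb hf).sub (IsHomogeneous.sum _ _ _ fun i _ => ?_)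
      rw [smul_eq_C_mul]
      exact (isHomogeneous_of_mem_span_pair_pow ha hb
        (prod_erase_mem_span_pow hj hZs i.2)).C_mul _
    · intro α hα
      rw [← Finset.add_sum_erase _ _ (Finset.mem_univ ⟨α, hα⟩), ← sub_sub]
      refine dvd_sub (hc ⟨α, hα⟩) (Finset.dvd_sum fun l hl => dvd_smul_of_dvd _
        (Finset.dvd_prod_of_mem _ (Finset.mem_erase.2 ⟨fun h => ?_, hα⟩)))
      exact (Finset.ne_of_mem_erase hl) (Subtype.ext h.symm)
  exact ⟨Module.Basis.mk hli hspan, fun i => by rw [Module.Basis.mk_apply]⟩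

theorem free_of_range_eq {R M N : Type*} [CommRing R] [AddCommGroup M] [Module R M]
    [AddCommGroup N] [Module R N] [Module.Free R M] (f : M →ₗ[R] N) (hf : Function.Injective f)
    {P : Submodule R N} (h : LinearMap.range f = P) : Module.Free R P := by
  subst h
  exact Module.Free.of_equiv (LinearEquiv.ofInjective f hf)

end Pencil

/-! ### Freeness on binary forms -/

section PencilFree

variable {σ : Type*} {a b : MvPolynomial σ K} {A Z : Finset (MvPolynomial σ K)} {j : ℕ}

-- In the interpolation basis the vector omitting `i` is divisible by every element of `A` except
-- possibly `i`. Hence its value may be an arbitrary multiple of `P i`, and these values are chosen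
-- independently of each other.
open Classical in
theorem free_admissible_span_pow_of_subset (ha : a.IsHomogeneous 1)
    (hb : b.IsHomogeneous 1) (hab : LinearIndependent K ![a, b]) (hZ : IsReducedForms Z)
    (hZs : ∀ α ∈ Z, α ∈ Submodule.span K {a, b}) (hj : Z.card = j + 1) (hAZ : A ⊆ Z) :
    Module.Free (MvPolynomial σ K) (admissible (Submodule.span K {a, b} ^ j) A) := by
  obtain ⟨B, hB⟩ := exists_basis_span_pow ha hb hab hZ hZs hj
  let P : Z → MvPolynomial σ K := fun i => ∏ α ∈ A.erase (i : MvPolynomial σ K), α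
  have hP : ∀ i, P i ≠ 0 := fun i =>
    (hZ.mono ((Finset.erase_subset _ _).trans hAZ)).prod_ne_zero
  let f : (Z → MvPolynomial σ K) →ₗ[MvPolynomial σ K] _ :=
    (B.constr (MvPolynomial σ K)).toLinearMap ∘ₗ
      LinearMap.pi fun i => P i • LinearMap.proj (R := MvPolynomial σ K) (φ := fun _ : Z => MvPolynomial σ K) i
  have hf : ∀ s i, f s (B i) = P i * s i := fun s i => by
    simp only [f, LinearMap.comp_apply, LinearEquiv.coe_coe, Module.Basis.constr_basis]
    rfl
  refine free_of_range_eq f ?_ (le_antisymm ?_ ?_)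
  · rw [injective_iff_map_eq_zero]
    intro s hs
    funext i
    have := hf s i
    rw [hs, LinearMap.zero_apply] at this
    exact (mul_eq_zero.1 this.symm).resolve_left (hP i)
  · rintro _ ⟨s, rfl⟩ α hα g hg
    rw [← B.sum_repr g] at hg ⊢
    simp only [AddSubmonoidClass.coe_finsetSum, Submodule.coe_smul, hB] at hg
    rw [map_sum]
    refine Finset.dvd_sum fun i _ => ?_
    rw [map_smul, hf]
    by_cases hi : (i : MvPolynomial σ K) = α
    · subst hi
      rw [coeff_eq_zero_of_dvd_sum hZ hg, zero_smul]
      exact dvd_zero _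
    · exact dvd_smul_of_dvd _ (Dvd.dvd.mul_right
        (Finset.dvd_prod_of_mem _ (Finset.mem_erase.2 ⟨Ne.symm hi, hα⟩)) _)
  · intro φ hφ
    have : ∀ i, P i ∣ φ (B i) := fun i => by
      refine (hZ.mono ((Finset.erase_subset _ _).trans hAZ)).prod_dvd fun α hα => ?_
      obtain ⟨hαi, hαA⟩ := Finset.mem_erase.1 hα
      refine hφ α hαA _ ?_
      rw [hB]
      exact Finset.dvd_prod_of_mem _ (Finset.mem_erase.2 ⟨hαi, hAZ hαA⟩)
    choose s hs using this
    exact ⟨s, B.ext fun i => by rw [hf, hs]⟩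

-- Elements of `A` outside `Z` divide no basis vector, but modulo such an element all basis vectors
-- are proportional. Subtracting a multiple of the inclusion makes an admissible map vanish at one
-- vector `o`. The value at any other vector `i` is then divisible by all of `A` except possibly
-- `i`. A basis thus consists of the inclusion and one map for each `i ≠ o`.
open Classical in
theorem free_admissible_span_pow_of_superset (ha : a.IsHomogeneous 1)
    (hb : b.IsHomogeneous 1) (hab : LinearIndependent K ![a, b]) (hA : IsReducedForms A)
    (hAs : ∀ α ∈ A, α ∈ Submodule.span K {a, b}) (hj : Z.card = j + 1) (hZA : Z ⊆ A) :
    Module.Free (MvPolynomial σ K) (admissible (Submodule.span K {a, b} ^ j) A) := by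
  have hZ := hA.mono hZA
  obtain ⟨B, hB⟩ := exists_basis_span_pow ha hb hab hZ (fun α hα => hAs α (hZA hα)) hj
  obtain ⟨i₀, hi₀⟩ : ∃ i, i ∈ Z := Finset.card_pos.1 (by omega)
  let o : Z := ⟨i₀, hi₀⟩
  let P : Z → MvPolynomial σ K := fun i => ∏ α ∈ A.erase (i : MvPolynomial σ K), α
  have hP : ∀ i, P i ≠ 0 := fun i => (hA.mono (Finset.erase_subset _ _)).prod_ne_zero
  have hB0 : ∀ i, (B i : MvPolynomial σ K) ≠ 0 := fun i => by
    rw [hB]; exact (hZ.mono (Finset.erase_subset _ _)).prod_ne_zero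
  have hnd : ∀ i : Z, ∀ α ∈ A, α ∉ Z → ¬ α ∣ (B i : MvPolynomial σ K) := fun i α hα hαZ => by
    rw [hB]
    exact hA.not_dvd_prod ((Finset.erase_subset _ _).trans hZA) hα
      fun h => hαZ (Finset.mem_of_mem_erase h)
  let p : Z → (Z → MvPolynomial σ K) →ₗ[MvPolynomial σ K] MvPolynomial σ K := fun i =>
    LinearMap.proj (R := MvPolynomial σ K) (φ := fun _ : Z => MvPolynomial σ K) i
  let f : (Z → MvPolynomial σ K) →ₗ[MvPolynomial σ K] _ :=
    (B.constr (MvPolynomial σ K)).toLinearMap ∘ₗ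
      LinearMap.pi fun i => (B i : MvPolynomial σ K) • p o + if i = o then 0 else P i • p i
  have hf : ∀ s i, f s (B i) = B i * s o + if i = o then 0 else P i * s i := fun s i => by
    simp only [f, LinearMap.comp_apply, LinearEquiv.coe_coe, Module.Basis.constr_basis]
    split_ifs with h <;> simp [h, p]
  refine free_of_range_eq f ?_ (le_antisymm ?_ ?_)
  · rw [injective_iff_map_eq_zero]
    intro s hs
    have h0 : s o = 0 := by
      have := hf s o
      rw [hs, LinearMap.zero_apply, if_pos rfl, add_zero] at this
      exact (mul_eq_zero.1 this.symm).resolve_left (hB0 o)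
    funext i
    by_cases hi : i = o
    · rw [hi, h0]; rfl
    · have := hf s i
      rw [hs, LinearMap.zero_apply, if_neg hi, h0, mul_zero, zero_add] at this
      exact (mul_eq_zero.1 this.symm).resolve_left (hP i)
  · rintro _ ⟨s, rfl⟩ α hα g hg
    have hfg : f s g = g * s o + ∑ i, B.repr g i • if i = o then 0 else P i * s i := by
      conv_lhs => rw [← B.sum_repr g, map_sum]
      simp only [map_smul, hf, smul_add, Finset.sum_add_distrib]
      congr 1
      conv_rhs => rw [← B.sum_repr g]
      simp only [AddSubmonoidClass.coe_finsetSum, Submodule.coe_smul, Finset.sum_mul,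
        smul_mul_assoc]
    rw [hfg]
    refine dvd_add (Dvd.dvd.mul_right hg _) (Finset.dvd_sum fun i _ => ?_)
    by_cases hi : (i : MvPolynomial σ K) = α
    · subst hi
      rw [← B.sum_repr g] at hg
      simp only [AddSubmonoidClass.coe_finsetSum, Submodule.coe_smul, hB] at hg
      rw [coeff_eq_zero_of_dvd_sum hZ hg, zero_smul]
      exact dvd_zero _
    · refine dvd_smul_of_dvd _ ?_
      split_ifs
      · exact dvd_zero _
      · exact Dvd.dvd.mul_right
          (Finset.dvd_prod_of_mem _ (Finset.mem_erase.2 ⟨Ne.symm hi, hα⟩)) _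
  · intro φ hφ
    have hBd : ∀ i : Z, (B i : MvPolynomial σ K) ∣ φ (B i) := fun i => by
      rw [hB]
      refine (hZ.mono (Finset.erase_subset _ _)).prod_dvd fun α hα => ?_
      refine hφ α (hZA (Finset.mem_of_mem_erase hα)) _ ?_
      rw [hB]
      exact Finset.dvd_prod_of_mem _ hα
    obtain ⟨d, hd⟩ := hBd o
    have hφ' : ∀ α ∈ A, ∀ g : (Submodule.span K {a, b} ^ j : Submodule K (MvPolynomial σ K)),
        α ∣ (g : MvPolynomial σ K) → α ∣ φ g - g * d := fun α hα g hg =>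
      dvd_sub (hφ α hα g hg) (Dvd.dvd.mul_right hg _)
    have : ∀ i, i ≠ o → P i ∣ φ (B i) - B i * d := fun i hi => by
      refine (hA.mono (Finset.erase_subset _ _)).prod_dvd fun α hα => ?_
      obtain ⟨hαi, hαA⟩ := Finset.mem_erase.1 hα
      by_cases hαZ : α ∈ Z
      · refine hφ' α hαA _ ?_
        rw [hB]
        exact Finset.dvd_prod_of_mem _ (Finset.mem_erase.2 ⟨hαi, hαZ⟩)
      -- Here `α` divides `B i - c • B o`, and the corrected map vanishes at `B o`, so the condition
      -- falls on its value at `B i` alone.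
      · obtain ⟨c, hc⟩ := exists_dvd_sub_smul_of_not_dvd ha hb hab (hAs α hαA)
          (hA.ne_zero α hαA) (B i).2 (B o).2 (hnd o α hαA hαZ)
        have := hφ' α hαA (B i - c • B o) (by simpa using hc)
        rwa [map_sub, map_smul, hd, Submodule.coe_sub, Submodule.coe_smul, sub_mul,
          smul_mul_assoc, sub_sub_sub_cancel_right] at this
    have h2 : ∀ i, ∃ s, i ≠ o → φ (B i) = B i * d + P i * s := fun i => by
      by_cases hi : i = o
      · exact ⟨0, fun h => absurd hi h⟩
      · obtain ⟨s, hs⟩ := this i hi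
        exact ⟨s, fun _ => by rw [← hs]; ring⟩
    choose s hs using h2
    refine ⟨fun i => if i = o then d else s i, B.ext fun i => ?_⟩
    rw [hf]
    by_cases hi : i = o
    · simp [hi, hd]
    · simp [hi, hs i hi]

/-- Freeness for the forms of degree `j` in a pencil containing all of `A`. -/
theorem free_admissible_span_pow [Infinite K] (ha : a.IsHomogeneous 1)
    (hb : b.IsHomogeneous 1) (hab : LinearIndependent K ![a, b]) (hA : IsReducedForms A)
    (hAs : ∀ α ∈ A, α ∈ Submodule.span K {a, b}) (j : ℕ) :
    Module.Free (MvPolynomial σ K) (admissible (Submodule.span K {a, b} ^ j) A) := by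
  rcases le_total A.card (j + 1) with h | h
  · obtain ⟨Z, hAZ, hZ, hc, hs⟩ := hA.exists_superset ha hb hab h
    exact free_admissible_span_pow_of_subset ha hb hab hZ
      (fun α hα => by by_cases h : α ∈ A; exacts [hAs α h, hs α hα h]) hc hAZ
  · obtain ⟨Z, hZA, hc⟩ := Finset.exists_subset_card_eq h
    exact free_admissible_span_pow_of_superset ha hb hab hA hAs hc hZA

end PencilFree

/-! ### Three variables, all lines through one point -/

/-- Complementary coordinate of a pencil: a form `z`, and a retraction onto `K[a, b]` killing it. -/
theorem exists_complement {a b : MvPolynomial (Fin 3) K} (ha : a.IsHomogeneous 1)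
    (hb : b.IsHomogeneous 1) (hab : LinearIndependent K ![a, b]) :
    ∃ (z : MvPolynomial (Fin 3) K) (ρ : MvPolynomial (Fin 3) K →ₐ[K] MvPolynomial (Fin 3) K),
      z.IsHomogeneous 1 ∧ z ≠ 0 ∧ ρ a = a ∧ ρ b = b ∧ ρ z = 0 ∧
      ∀ d, ∀ f ∈ Forms K (d + 1), ∃ t ∈ Submodule.span K {a, b} ^ (d + 1),
        ∃ g ∈ Forms K d, t + z * g = f := by
  obtain ⟨σ, h0, h1, hσ, hσ'⟩ := exists_algEquiv ha hb hab
  have hz : (σ (X 2)).IsHomogeneous 1 := hσ 1 _ (isHomogeneous_X K 2)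
  have hz0 : σ (X 2) ≠ 0 := by simp
  refine ⟨σ (X 2), (aeval ![a, b, 0]).comp σ.symm.toAlgHom, hz, hz0, ?_, ?_, ?_, ?_⟩
  · rw [← h0]; simp
  · rw [← h1]; simp
  · simp
  · have hlin : ∀ f ∈ Forms K 1, ∃ t ∈ Submodule.span K {a, b}, σ (X 2) ∣ f - t := by
      intro f hf
      have hg : σ.symm f ∈ homogeneousSubmodule (Fin 3) K 1 := hσ' 1 f hf
      rw [homogeneousSubmodule_one_eq_span_X, Submodule.mem_span_range_iff_exists_fun] at hg
      obtain ⟨c, hc⟩ := hg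
      refine ⟨c 0 • a + c 1 • b, Submodule.mem_span_pair.2 ⟨_, _, rfl⟩, C (c 2), ?_⟩
      rw [← σ.apply_symm_apply f, ← hc, Fin.sum_univ_three]
      simp only [map_add, map_smul, h0, h1]
      rw [add_sub_cancel_left, smul_eq_C_mul, mul_comm]
    have key : ∀ d, ∀ f ∈ Forms K d, ∃ t ∈ Submodule.span K {a, b} ^ d, σ (X 2) ∣ f - t := by
      intro d
      induction d with
      | zero =>
        intro f hf
        refine ⟨f, ?_, by rw [sub_self]; exact dvd_zero _⟩
        rwa [pow_zero, ← homogeneousSubmodule_zero]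
      | succ d ih =>
        intro f hf
        rw [Forms, ← homogeneousSubmodule_one_pow, pow_succ, homogeneousSubmodule_one_pow] at hf
        refine Submodule.mul_induction_on hf (fun m hm n hn => ?_) fun x y hx hy => ?_
        · obtain ⟨t, ht, u, hu⟩ := ih m hm
          obtain ⟨s, hs, v, hv⟩ := hlin n hn
          refine ⟨t * s, by rw [pow_succ]; exact Submodule.mul_mem_mul ht hs,
            n * u + t * v, ?_⟩
          linear_combination n * hu + t * hv
        · obtain ⟨t, ht, hd⟩ := hx
          obtain ⟨t', ht', hd'⟩ := hy
          refine ⟨t + t', Submodule.add_mem _ ht ht', ?_⟩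
          rw [add_sub_add_comm]
          exact dvd_add hd hd'
    intro d f hf
    obtain ⟨t, ht, g, hg⟩ := key _ f hf
    refine ⟨t, ht, g, ?_, by rw [← hg, add_sub_cancel]⟩
    refine isHomogeneous_of_mul hz hz0 ?_
    rw [← hg]
    exact IsHomogeneous.sub hf (isHomogeneous_of_mem_span_pair_pow ha hb ht)

theorem pencil_fixed {a b f : MvPolynomial (Fin 3) K}
    {ρ : MvPolynomial (Fin 3) K →ₐ[K] MvPolynomial (Fin 3) K} (ha : ρ a = a) (hb : ρ b = b) {d : ℕ}
    (hf : f ∈ Submodule.span K {a, b} ^ d) : ρ f = f := by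
  have h1 : ∀ g ∈ Submodule.span K {a, b}, ρ g = g := fun g hg => by
    obtain ⟨s, t, rfl⟩ := Submodule.mem_span_pair.1 hg
    rw [map_add, map_smul, map_smul, ha, hb]
  induction d generalizing f with
  | zero =>
    rw [pow_zero, Submodule.mem_one] at hf
    obtain ⟨c, rfl⟩ := hf
    exact ρ.commutes c
  | succ d ih =>
    rw [pow_succ] at hf
    refine Submodule.mul_induction_on hf (fun m hm n hn => ?_) fun x y hx hy => ?_
    · rw [map_mul, ih hm, h1 n hn]
    · rw [map_add, hx, hy]

/-- Freeness for forms of all degrees in three variables, if all lines pass through a point. -/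
theorem free_admissible_forms_of_subset_pencil [Infinite K] {a b : MvPolynomial (Fin 3) K}
    (ha : a.IsHomogeneous 1) (hb : b.IsHomogeneous 1) (hab : LinearIndependent K ![a, b])
    {A : Finset (MvPolynomial (Fin 3) K)} (hA : IsReducedForms A)
    (hAs : ∀ α ∈ A, α ∈ Submodule.span K {a, b}) (d : ℕ) :
    Module.Free (MvPolynomial (Fin 3) K) (admissible (Forms K d) A) := by
  obtain ⟨z, ρ, hz, hz0, hρa, hρb, hρz, hdec⟩ := exists_complement ha hb hab
  have hρA : ∀ α ∈ A, ρ α = α := fun α hα =>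
    pencil_fixed hρa hρb (d := 1) (by rw [pow_one]; exact hAs α hα)
  have hzA : ∀ α ∈ A, ¬ α ∣ z := fun α hα h => by
    obtain ⟨g, hg⟩ := dvd_symm_of_isHomogeneous_one (hA.homog α hα) hz hz0 h
    have := hρA α hα
    rw [hg, map_mul, hρz, zero_mul, ← hg] at this
    exact hA.ne_zero α hα this.symm
  induction d with
  | zero =>
    have h := free_admissible_span_pow ha hb hab hA hAs 0
    rwa [pow_zero, ← homogeneousSubmodule_zero] at h
  | succ d ih =>
    -- `S_{d+1}` splits into the forms in `a, b` and the multiples of `z`. No element of `A` divides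
    -- `z`, so the second piece reduces to `S_d` with the same `A`.
    let Cs : Bool → Submodule K (MvPolynomial (Fin 3) K) := fun i =>
      if i then Submodule.span K {a, b} ^ (d + 1) else (Forms K d).map (LinearMap.mulLeft K z)
    have hmem : ∀ g : ∀ i, Cs i, ρ (g true) = g true ∧ ∃ u ∈ Forms K d, z * u = g false :=
      fun g => ⟨pencil_fixed hρa hρb (g true).2, (Submodule.mem_map.1 (g false).2)⟩
    refine free_admissible_of_decomposition Cs ?_ ?_ ?_ ?_ ?_
    · rintro (_ | _) f hf
      · obtain ⟨u, hu, rfl⟩ := Submodule.mem_map.1 hf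
        have := hz.mul hu
        rwa [add_comm] at this
      · exact isHomogeneous_of_mem_span_pair_pow ha hb hf
    · intro g hg
      obtain ⟨h1, u, hu, h2⟩ := hmem g
      rw [Fintype.sum_bool, ← h2] at hg
      have h3 := congrArg ρ hg
      rw [map_add, h1, map_mul, hρz, zero_mul, add_zero, map_zero] at h3
      rw [h3, zero_add, h2] at hg
      funext i
      rcases i with _ | _
      · exact Subtype.ext hg
      · exact Subtype.ext h3
    · intro f hf
      obtain ⟨t, ht, g, hg, rfl⟩ := hdec d f hf
      refine ⟨fun i => match i with
        | true => ⟨t, ht⟩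
        | false => ⟨z * g, Submodule.mem_map.2 ⟨g, hg, rfl⟩⟩, ?_⟩
      rw [Fintype.sum_bool]
    · intro α hα g hg
      obtain ⟨h1, u, hu, h2⟩ := hmem g
      rw [Fintype.sum_bool] at hg
      -- The retraction `ρ` fixes `α` and isolates the part without `z`, so divisibility of the sum
      -- passes to that part and then to the other.
      have h3 : α ∣ (g true : MvPolynomial (Fin 3) K) := by
        have := map_dvd ρ hg
        rwa [hρA α hα, ← h2, map_add, h1, map_mul, hρz, zero_mul, add_zero] at this
      rintro (_ | _)
      · exact (dvd_add_right h3).1 hg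
      · exact h3
    · rintro (_ | _)
      · exact free_admissible_mul hz0 (fun α hα => hA.prime hα) hA.eq_of_dvd
          (fun α => ⟨fun h => ⟨h, hzA α h⟩, fun h => h.1⟩) ih
      · exact free_admissible_span_pow ha hb hab hA hAs (d + 1)

/-! ### Ideals of a point and their primary thickenings -/

theorem isPrime_span_pair {a b : MvPolynomial (Fin 3) K} (ha : a.IsHomogeneous 1)
    (hb : b.IsHomogeneous 1) (hab : LinearIndependent K ![a, b]) :
    (Ideal.span {a, b}).IsPrime := by
  obtain ⟨σ, h0, h1, -, -⟩ := exists_algEquiv ha hb hab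
  -- In coordinates starting with `a, b`, the map `τ` sets these two to zero and keeps the third.
  -- The ideal is its kernel, and the target is a domain.
  set τ : MvPolynomial (Fin 3) K →ₐ[K] MvPolynomial (Fin 3) K :=
    (aeval ![0, 0, σ (X 2)]).comp σ.symm.toAlgHom with hτ
  have hτσ : ∀ i, τ (σ (X i)) = ![0, 0, σ (X 2)] i := fun i => by
    simp [hτ]
  have h : (Ideal.Quotient.mkₐ K (Ideal.span {a, b})).comp (τ.comp σ.toAlgHom) =
      (Ideal.Quotient.mkₐ K (Ideal.span {a, b})).comp σ.toAlgHom := by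
    refine algHom_ext fun i => ?_
    change Ideal.Quotient.mkₐ K _ (τ (σ (X i))) = Ideal.Quotient.mkₐ K _ (σ (X i))
    rw [hτσ]
    fin_cases i
    · simp only [Fin.zero_eta, Matrix.cons_val_zero, map_zero, h0]
      exact (Ideal.Quotient.eq_zero_iff_mem.2 (Ideal.subset_span (by simp))).symm
    · simp only [Fin.mk_one, Matrix.cons_val_one, Matrix.cons_val_zero, map_zero, h1]
      exact (Ideal.Quotient.eq_zero_iff_mem.2 (Ideal.subset_span (by simp))).symm
    · rfl
  have hker : Ideal.span {a, b} = RingHom.ker τ := by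
    refine le_antisymm (Ideal.span_le.2 ?_) fun f hf => ?_
    · rintro x (rfl | rfl)
      · have := hτσ 0
        rwa [h0] at this
      · have := hτσ 1
        rwa [h1] at this
    · have h' := DFunLike.congr_fun h (σ.symm f)
      change Ideal.Quotient.mk _ (τ (σ (σ.symm f))) = Ideal.Quotient.mk _ (σ (σ.symm f)) at h'
      rw [σ.apply_symm_apply, RingHom.mem_ker.1 hf, map_zero] at h'
      exact Ideal.Quotient.eq_zero_iff_mem.1 h'.symm
  rw [hker]
  exact RingHom.ker_isPrime _

/-- The ideal `(α, β ^ e)` is primary to the prime ideal `(α, β)`. -/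
theorem mem_span_pow_of_mul_mem {R : Type*} [CommRing R] {α β p f : R} (hα : Prime α)
    (hαβ : ¬ α ∣ β) (hP : (Ideal.span {α, β}).IsPrime) (hp : p ∉ Ideal.span {α, β}) {e : ℕ}
    (h : p * f ∈ Ideal.span {α, β ^ e}) : f ∈ Ideal.span {α, β ^ e} := by
  induction e with
  | zero => rw [pow_zero]; exact Ideal.mem_span_pair.2 ⟨0, f, by ring⟩
  | succ e ih =>
    obtain ⟨u, v, huv⟩ := Ideal.mem_span_pair.1 h
    obtain ⟨u', v', rfl⟩ := Ideal.mem_span_pair.1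
      (ih (Ideal.mem_span_pair.2 ⟨u, v * β, by rw [← huv]; ring⟩))
    -- By induction `f = u' α + v' β ^ e`. Cancelling `β ^ e` modulo `α` puts `p v'` in `(α, β)`, so
    -- `v'` supplies one more factor `β` modulo `α`.
    have h1 : α ∣ β ^ e * (p * v' - v * β) := ⟨u - p * u', by linear_combination -huv⟩
    have h2 := (hα.dvd_or_dvd h1).resolve_left fun h => hαβ (hα.dvd_of_dvd_pow h)
    obtain ⟨w, hw⟩ := h2
    have h3 : v' ∈ Ideal.span {α, β} := (hP.mem_or_mem (Ideal.mem_span_pair.2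
      ⟨w, v, by linear_combination -hw⟩ : p * v' ∈ _)).resolve_left hp
    obtain ⟨r, s, rfl⟩ := Ideal.mem_span_pair.1 h3
    exact Ideal.mem_span_pair.2 ⟨u' + r * β ^ e, s, by ring⟩

/-- In degrees below `e` the generator `β ^ e` contributes nothing. -/
theorem dvd_of_mem_span_pow {σ : Type*} {α β f : MvPolynomial σ K} (hα : α.IsHomogeneous 1)
    (hβ : β.IsHomogeneous 1) {d e : ℕ} (hf : f.IsHomogeneous d) (hde : d < e)
    (h : f ∈ Ideal.span {α, β ^ e}) : α ∣ f := by
  obtain ⟨u, v, huv⟩ := Ideal.mem_span_pair.1 h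
  have hβe : (β ^ e).IsHomogeneous e := by simpa using hβ.pow e
  rw [← homogeneousComponent_eq_self hf, ← huv, map_add, homogeneousComponent_mul_of_lt hβe hde,
    add_zero]
  cases d with
  | zero => rw [homogeneousComponent_mul_of_lt hα one_pos]; exact dvd_zero _
  | succ d => rw [homogeneousComponent_add_mul hα]; exact dvd_mul_left _ _

theorem mem_span_of_mem_ideal_span {σ : Type*} {α β γ : MvPolynomial σ K}
    (hα : α.IsHomogeneous 1) (hβ : β.IsHomogeneous 1) (hγ : γ.IsHomogeneous 1)
    (h : γ ∈ Ideal.span {α, β}) : γ ∈ Submodule.span K {α, β} := by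
  obtain ⟨u, v, huv⟩ := Ideal.mem_span_pair.1 h
  have hu := homogeneousComponent_add_mul hα (g := u) 0
  have hv := homogeneousComponent_add_mul hβ (g := v) 0
  rw [homogeneousComponent_zero] at hu hv
  refine Submodule.mem_span_pair.2 ⟨coeff 0 u, coeff 0 v, ?_⟩
  rw [smul_eq_C_mul, smul_eq_C_mul, ← hu, ← hv, ← map_add, huv, zero_add,
    homogeneousComponent_eq_self hγ]

/-! ### Intersection points and the count of pairs -/

section Points

open Classical in
/-- The subspaces spanned by two distinct elements of `A`. -/
noncomputable def points {σ : Type*} (A : Finset (MvPolynomial σ K)) :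
    Finset (Submodule K (MvPolynomial σ K)) :=
  A.offDiag.image fun p => Submodule.span K {p.1, p.2}

open Classical in
/-- The elements of `A` lying in `X`. -/
noncomputable def localForms {σ : Type*} (A : Finset (MvPolynomial σ K))
    (X : Submodule K (MvPolynomial σ K)) : Finset (MvPolynomial σ K) :=
  A.filter (· ∈ X)

open Classical in
/-- The product of the elements of `A` outside `X`. -/
noncomputable def coProd {σ : Type*} (A : Finset (MvPolynomial σ K))
    (X : Submodule K (MvPolynomial σ K)) : MvPolynomial σ K :=
  ∏ α ∈ A.filter (· ∉ X), α

variable {σ : Type*} {A : Finset (MvPolynomial σ K)} {X : Submodule K (MvPolynomial σ K)}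

theorem mem_localForms {α : MvPolynomial σ K} : α ∈ localForms A X ↔ α ∈ A ∧ α ∈ X := by
  classical
  exact Finset.mem_filter

theorem IsReducedForms.linearIndependent (hA : IsReducedForms A) {α β : MvPolynomial σ K}
    (hα : α ∈ A) (hβ : β ∈ A) (h : α ≠ β) : LinearIndependent K ![α, β] :=
  linearIndependent_of_not_dvd (hA.ne_zero α hα) fun hd => h (hA.eq_of_dvd α hα β hβ hd)

theorem IsReducedForms.eq_span (hA : IsReducedForms A) (hX : X ∈ points A)
    {α β : MvPolynomial σ K} (hα : α ∈ localForms A X) (hβ : β ∈ localForms A X) (h : α ≠ β) :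
    X = Submodule.span K {α, β} := by
  classical
  obtain ⟨p, hp, rfl⟩ := Finset.mem_image.1 hX
  rw [mem_localForms] at hα hβ
  exact (span_pair_eq_of_linearIndependent hα.2 hβ.2 (hA.linearIndependent hα.1 hβ.1 h)).symm

theorem exists_of_mem_points (hX : X ∈ points A) :
    ∃ α ∈ A, ∃ β ∈ A, α ≠ β ∧ X = Submodule.span K {α, β} := by
  classical
  obtain ⟨p, hp, rfl⟩ := Finset.mem_image.1 hX
  obtain ⟨h1, h2, h3⟩ := Finset.mem_offDiag.1 hp
  exact ⟨_, h1, _, h2, h3, rfl⟩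

theorem exists_ne_mem_localForms (hX : X ∈ points A) (α : MvPolynomial σ K) :
    ∃ β ∈ localForms A X, α ≠ β := by
  obtain ⟨γ, hγ, δ, hδ, h, rfl⟩ := exists_of_mem_points hX
  by_cases hα : α = γ
  · exact ⟨δ, mem_localForms.2 ⟨hδ, Submodule.subset_span (by simp)⟩, hα ▸ h⟩
  · exact ⟨γ, mem_localForms.2 ⟨hγ, Submodule.subset_span (by simp)⟩, hα⟩

theorem two_le_card_localForms (hX : X ∈ points A) : 2 ≤ (localForms A X).card := by
  obtain ⟨α, hα, -⟩ := exists_ne_mem_localForms hX 0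
  obtain ⟨β, hβ, h⟩ := exists_ne_mem_localForms hX α
  exact Finset.one_lt_card.2 ⟨α, hα, β, hβ, h⟩

theorem card_localForms_add (A : Finset (MvPolynomial σ K)) (X : Submodule K (MvPolynomial σ K))
    [DecidablePred (· ∉ X)] :
    (localForms A X).card + (A.filter (· ∉ X)).card = A.card := by
  classical
  rw [localForms]
  convert! Finset.card_filter_add_card_filter_not (s := A) (· ∈ X)

theorem IsReducedForms.isHomogeneous_coProd_mul (hA : IsReducedForms A) (hX : X ∈ points A) {m : ℕ}
    (hm : A.card = m + 2) {f : MvPolynomial σ K}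
    (hf : f.IsHomogeneous ((localForms A X).card - 2)) : (coProd A X * f).IsHomogeneous m := by
  classical
  have h1 := (hA.mono (Finset.filter_subset (· ∉ X) A)).isHomogeneous_prod.mul hf
  have h2 := card_localForms_add A X
  have h3 := two_le_card_localForms hX
  rwa [show (A.filter (· ∉ X)).card + ((localForms A X).card - 2) = m by omega] at h1

theorem IsReducedForms.coProd_ne_zero (hA : IsReducedForms A) : coProd A X ≠ 0 := by
  classical
  exact (hA.mono (Finset.filter_subset _ _)).prod_ne_zero

theorem dvd_coProd {α : MvPolynomial σ K} (hα : α ∈ A) (hX : α ∉ X) : α ∣ coProd A X := by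
  classical
  exact Finset.dvd_prod_of_mem _ (Finset.mem_filter.2 ⟨hα, hX⟩)

theorem IsReducedForms.not_dvd_coProd (hA : IsReducedForms A) {α : MvPolynomial σ K} (hα : α ∈ A)
    (hX : α ∈ X) : ¬ α ∣ coProd A X := by
  classical
  exact hA.not_dvd_prod (Finset.filter_subset _ _) hα fun h => (Finset.mem_filter.1 h).2 hX

/-- Counting pairs of elements of `A` by the subspace they span. -/
theorem IsReducedForms.sum_choose_localForms (hA : IsReducedForms A) :
    ∑ X ∈ points A, ((localForms A X).card).choose 2 = A.card.choose 2 := by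
  classical
  have h : ∑ X ∈ points A, (localForms A X).offDiag.card = A.offDiag.card := by
    rw [points, Finset.card_eq_sum_card_image (fun p => Submodule.span K {p.1, p.2}) A.offDiag]
    refine Finset.sum_congr rfl fun X hX => congrArg Finset.card ?_
    ext ⟨α, β⟩
    simp only [Finset.mem_offDiag, Finset.mem_filter, mem_localForms]
    constructor
    · rintro ⟨⟨hα, hαX⟩, ⟨hβ, hβX⟩, hne⟩
      exact ⟨⟨hα, hβ, hne⟩, (hA.eq_span hX (mem_localForms.2 ⟨hα, hαX⟩)
        (mem_localForms.2 ⟨hβ, hβX⟩) hne).symm⟩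
    · rintro ⟨⟨hα, hβ, hne⟩, rfl⟩
      exact ⟨⟨hα, Submodule.subset_span (by simp)⟩, ⟨hβ, Submodule.subset_span (by simp)⟩, hne⟩
  have h2 : ∀ B : Finset (MvPolynomial σ K), B.offDiag.card = 2 * B.card.choose 2 := fun B => by
    rw [Finset.offDiag_card, Nat.choose_two_right,
      Nat.mul_div_cancel' (Nat.even_mul_pred_self _).two_dvd, Nat.mul_sub, mul_one]
  simp only [h2, ← Finset.mul_sum] at h
  omega

end Points

/-! ### Decomposition of the forms of degree `m` by intersection points -/

/-- If `α ∈ A` divides a sum of terms supported at the points of `A`, it divides every term. -/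
theorem IsReducedForms.dvd_of_dvd_sum_points {A : Finset (MvPolynomial (Fin 3) K)}
    (hA : IsReducedForms A)
    {f : Submodule K (MvPolynomial (Fin 3) K) → MvPolynomial (Fin 3) K}
    (hf : ∀ X ∈ points A, (f X).IsHomogeneous ((localForms A X).card - 2))
    {α : MvPolynomial (Fin 3) K} (hα : α ∈ A) (h : α ∣ ∑ X ∈ points A, coProd A X * f X)
    {X : Submodule K (MvPolynomial (Fin 3) K)} (hX : X ∈ points A) (hαX : α ∈ X) : α ∣ f X := by
  classical
  have hαX' := mem_localForms.2 ⟨hα, hαX⟩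
  obtain ⟨β, hβX', hαβ⟩ := exists_ne_mem_localForms hX α
  obtain ⟨hβ, hβX⟩ := mem_localForms.1 hβX'
  have hXs := hA.eq_span hX hαX' hβX' hαβ
  have hli := hA.linearIndependent hα hβ hαβ
  have hα1 := hA.homog α hα
  have hβ1 := hA.homog β hβ
  have hprime := isPrime_span_pair hα1 hβ1 hli
  set e := (localForms A X).card - 1 with he
  have hk := two_le_card_localForms hX
  -- Every form in `X` is a multiple of `β` modulo `α`, so a product of `r` of them is a multiple of
  -- `β ^ r` modulo `α`.
  have hW : ∀ W : Finset (MvPolynomial (Fin 3) K), W ⊆ localForms A X →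
      ∏ γ ∈ W, γ ∈ Ideal.span {α, β ^ W.card} := by
    intro W
    induction W using Finset.induction_on with
    | empty => intro _; exact Ideal.mem_span_pair.2 ⟨0, 1, by simp⟩
    | insert x W hx ih =>
      intro hW
      obtain ⟨u, v, huv⟩ := Ideal.mem_span_pair.1 (ih fun y hy => hW (Finset.mem_insert_of_mem hy))
      have hxX := (mem_localForms.1 (hW (Finset.mem_insert_self _ _))).2
      rw [hXs] at hxX
      obtain ⟨s, t, hst⟩ := Submodule.mem_span_pair.1 hxX
      rw [Finset.prod_insert hx, Finset.card_insert_of_notMem hx, ← huv, ← hst, smul_eq_C_mul,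
        smul_eq_C_mul]
      exact Ideal.mem_span_pair.2 ⟨(C s * α + C t * β) * u + C s * v * β ^ W.card, C t * v, by ring⟩
  -- Let `k` be the number of lines in `X`. A point `Y ≠ X` on `α` lies on no other line through
  -- `X`, so its cofactor contains the `k - 1 = e` remaining lines of `X`. If `Y` is not on `α`, the
  -- cofactor contains `α` itself.
  have hother : ∀ Y ∈ (points A).erase X, coProd A Y * f Y ∈ Ideal.span {α, β ^ e} := by
    intro Y hY
    obtain ⟨hYX, hY⟩ := Finset.mem_erase.1 hY
    refine Ideal.mul_mem_right _ _ ?_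
    by_cases hαY : α ∈ Y
    · have hsub : (localForms A X).erase α ⊆ A.filter (· ∉ Y) := by
        intro γ hγ
        obtain ⟨hγα, hγ⟩ := Finset.mem_erase.1 hγ
        refine Finset.mem_filter.2 ⟨(mem_localForms.1 hγ).1, fun hγY => hYX ?_⟩
        rw [hA.eq_span hY (mem_localForms.2 ⟨hα, hαY⟩)
          (mem_localForms.2 ⟨(mem_localForms.1 hγ).1, hγY⟩) (Ne.symm hγα),
          hA.eq_span hX hαX' hγ (Ne.symm hγα)]
      have := hW _ (Finset.erase_subset α (localForms A X))
      rw [Finset.card_erase_of_mem hαX', ← he] at this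
      exact Ideal.mem_of_dvd _ (Finset.prod_dvd_prod_of_subset _ _ _ hsub) this
    · exact Ideal.mem_of_dvd _ (dvd_coProd hα hαY) (Ideal.subset_span (by simp))
  have hmain : coProd A X * f X ∈ Ideal.span {α, β ^ e} := by
    have h' : ∑ X ∈ points A, coProd A X * f X ∈ Ideal.span {α, β ^ e} :=
      Ideal.mem_of_dvd _ h (Ideal.subset_span (by simp))
    rw [← Finset.add_sum_erase _ _ hX] at h'
    exact (Ideal.add_mem_iff_left _ (Ideal.sum_mem _ hother)).1 h'
  -- No line outside `X` lies in the prime `(α, β)`, so `coProd A X` can be cancelled. Since `f X`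
  -- has degree `k - 2 < e`, membership in `(α, β ^ e)` forces `α ∣ f X`.
  refine dvd_of_mem_span_pow hα1 hβ1 (hf X hX) (e := e) (by omega)
    (mem_span_pow_of_mul_mem (hA.prime hα) (fun hd => hαβ (hA.eq_of_dvd α hα β hβ hd)) hprime ?_
      hmain)
  intro hmem
  obtain ⟨γ, hγ, hγP⟩ := (hprime.prod_mem_iff).1 hmem
  obtain ⟨hγA, hγX⟩ := Finset.mem_filter.1 hγ
  exact hγX (hXs ▸ mem_span_of_mem_ideal_span hα1 hβ1 (hA.homog γ hγA) hγP)

theorem IsReducedForms.dvd_of_dvd_sum_attach {A : Finset (MvPolynomial (Fin 3) K)}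
    (hA : IsReducedForms A) {f : points A → MvPolynomial (Fin 3) K}
    (hf : ∀ X, (f X).IsHomogeneous ((localForms A (X : Submodule K _)).card - 2))
    {α : MvPolynomial (Fin 3) K} (hα : α ∈ A) (h : α ∣ ∑ X : points A, coProd A X * f X)
    (X : points A) (hαX : α ∈ (X : Submodule K (MvPolynomial (Fin 3) K))) : α ∣ f X := by
  classical
  let F : Submodule K (MvPolynomial (Fin 3) K) → MvPolynomial (Fin 3) K := fun Y =>
    if hY : Y ∈ points A then f ⟨Y, hY⟩ else 0
  have hF : ∀ X : points A, F X = f X := fun X => dif_pos X.2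
  rw [← hF]
  refine hA.dvd_of_dvd_sum_points (f := F) (fun Y hY => ?_) hα ?_ X.2 hαX
  · rw [hF ⟨Y, hY⟩]
    exact hf ⟨Y, hY⟩
  · rw [← Finset.sum_coe_sort]
    simpa only [hF] using h

theorem finrank_forms_map_mulLeft (d : ℕ) {p : MvPolynomial (Fin 3) K} (hp : p ≠ 0) :
    Module.finrank K ((Forms K d).map (LinearMap.mulLeft K p)) = (d + 2).choose 2 := by
  rw [← finrank_forms (K := K) d]
  exact (Submodule.equivMapOfInjective (LinearMap.mulLeft K p)
    (fun _ _ h => mul_left_cancel₀ hp h) (Forms K d)).finrank_eq.symm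

/-- The forms `P_X f`, with `P_X` the product of the lines outside `X` and `f` a form of degree
`k - 2`, where `k` is the number of lines in `X`. -/
noncomputable def pointBlock (A : Finset (MvPolynomial (Fin 3) K))
    (X : Submodule K (MvPolynomial (Fin 3) K)) : Submodule K (MvPolynomial (Fin 3) K) :=
  (Forms K ((localForms A X).card - 2)).map (LinearMap.mulLeft K (coProd A X))

theorem finrank_pointBlock {A : Finset (MvPolynomial (Fin 3) K)} (hA : IsReducedForms A)
    {X : Submodule K (MvPolynomial (Fin 3) K)} (hX : X ∈ points A) :
    Module.finrank K (pointBlock A X) = ((localForms A X).card).choose 2 := by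
  rw [pointBlock, finrank_forms_map_mulLeft _ hA.coProd_ne_zero,
    Nat.sub_add_cancel (two_le_card_localForms hX)]

instance (A : Finset (MvPolynomial (Fin 3) K)) (X : Submodule K (MvPolynomial (Fin 3) K)) :
    Module.Finite K (pointBlock A X) := by
  unfold pointBlock; infer_instance

/-- Independent subspaces of the right total dimension span. -/
theorem exists_sum_eq_of_sum_finrank {M ι : Type*} [AddCommGroup M] [Module K M] [Fintype ι]
    [DecidableEq ι] {B : Submodule K M} [Module.Finite K B] (C : ι → Submodule K M)
    [∀ i, Module.Finite K (C i)] (hle : ∀ i, C i ≤ B)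
    (hinj : ∀ g : ∀ i, C i, ∑ i, (g i : M) = 0 → g = 0)
    (hdim : ∑ i, Module.finrank K (C i) = Module.finrank K B) {f : M} (hf : f ∈ B) :
    ∃ g : ∀ i, C i, ∑ i, (g i : M) = f := by
  let s : (∀ i, C i) →ₗ[K] B :=
    LinearMap.lsum K (fun i => C i) K fun i => Submodule.inclusion (hle i)
  have hs : ∀ g, (s g : M) = ∑ i, (g i : M) := fun g => by
    simp [s, LinearMap.lsum_apply]
  have hsi : Function.Injective s :=
    (injective_iff_map_eq_zero s).2 fun g hg => hinj g (by rw [← hs, hg]; rfl)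
  have hdim' : Module.finrank K (∀ i, C i) = Module.finrank K B := by
    rw [Module.finrank_pi_fintype, hdim]
  obtain ⟨g, hg⟩ := (LinearMap.injective_iff_surjective_of_finrank_eq_finrank hdim').1 hsi ⟨f, hf⟩
  exact ⟨g, by rw [← hs, hg]⟩

/-- Freeness for forms of degree `m` in three variables and at most `m + 2` lines. -/
theorem free_admissible_forms_of_card_le [Infinite K] {A : Finset (MvPolynomial (Fin 3) K)}
    (hA : IsReducedForms A) {m : ℕ} (hm : A.card ≤ m + 2) :
    Module.Free (MvPolynomial (Fin 3) K) (admissible (Forms K m) A) := by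
  classical
  -- Padding to exactly `m + 2` lines makes the dimensions match. The added lines shape the
  -- decomposition only; admissibility is still required along `A` alone.
  obtain ⟨B, hAB, hB, hc, -⟩ := hA.exists_superset (isHomogeneous_X K 0) (isHomogeneous_X K 1)
    (linearIndependent_of_not_dvd (X_ne_zero _) (fun h => by
      obtain ⟨c, hc⟩ := exists_smul_of_dvd (isHomogeneous_X K 0) (isHomogeneous_X K (1 : Fin 3)) h
      have := congrArg (eval ![0, 1, 0]) hc
      simp at this)) hm
  have hrep : ∀ g : ∀ i : points B, pointBlock B i, ∃ f : points B → MvPolynomial (Fin 3) K,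
      (∀ X, (f X).IsHomogeneous ((localForms B (X : Submodule K _)).card - 2)) ∧
      ∀ X, (g X : MvPolynomial (Fin 3) K) = coProd B X * f X := fun g => by
    choose f hf hg using fun X => Submodule.mem_map.1 (g X).2
    exact ⟨f, hf, fun X => (hg X).symm⟩
  have hle : ∀ i : points B, pointBlock B i ≤ Forms K m := by
    rintro X _ ⟨f, hf, rfl⟩
    exact hB.isHomogeneous_coProd_mul X.2 hc hf
  have hinj : ∀ g : ∀ i : points B, pointBlock B i, ∑ i, (g i : MvPolynomial (Fin 3) K) = 0 → g = 0 := by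
    intro g hg
    obtain ⟨f, hf, hgf⟩ := hrep g
    simp only [hgf] at hg
    funext X
    ext1
    rw [hgf]
    have h2 := two_le_card_localForms X.2
    -- Zero is divisible by every line, so `f X`, of degree `k - 2`, is divisible by all `k` lines
    -- through `X`.
    rw [(hB.mono (Finset.filter_subset (· ∈ (X : Submodule K _)) B)).eq_zero_of_forall_dvd (hf X)
      (show _ < (localForms B (X : Submodule K _)).card by omega) fun α hα =>
        hB.dvd_of_dvd_sum_attach hf (mem_localForms.1 hα).1 (hg ▸ dvd_zero α) X
          (mem_localForms.1 hα).2]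
    simp
  refine free_admissible_of_decomposition (fun X : points B => pointBlock B X) hle hinj ?_ ?_ ?_
  · intro f hf
    refine exists_sum_eq_of_sum_finrank _ hle hinj ?_ hf
    rw [finrank_forms, ← hc, ← hB.sum_choose_localForms,
      ← Finset.sum_coe_sort (points B) fun X => ((localForms B X).card).choose 2]
    exact Finset.sum_congr rfl fun X _ => finrank_pointBlock hB X.2
  · intro α hα g hg X
    obtain ⟨f, hf, hgf⟩ := hrep g
    simp only [hgf] at hg ⊢
    by_cases hX : α ∈ (X : Submodule K (MvPolynomial (Fin 3) K))
    · exact Dvd.dvd.mul_left (hB.dvd_of_dvd_sum_attach hf (hAB hα) hg X hX) _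
    · exact Dvd.dvd.mul_right (dvd_coProd (hAB hα) hX) _
  · intro X
    refine free_admissible_mul hB.coProd_ne_zero (fun α hα => hA.prime hα) hA.eq_of_dvd
      (A₂ := localForms A X) (fun α => ?_) ?_
    · rw [mem_localForms]
      refine and_congr_right fun hα => ⟨fun h => hB.not_dvd_coProd (hAB hα) h, fun h => ?_⟩
      by_contra hX
      exact h (dvd_coProd (hAB hα) hX)
    -- The pencil is spanned by two forms of `B`, since `A` may have fewer than two lines through
    -- `X`.
    · obtain ⟨α, hα, β, hβ, hαβ, hX⟩ := exists_of_mem_points X.2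
      refine free_admissible_forms_of_subset_pencil (hB.homog α hα) (hB.homog β hβ)
        (hB.linearIndependent hα hβ hαβ) (hA.mono (Finset.filter_subset _ _)) (fun γ hγ => ?_) _
      rw [← hX]
      exact (mem_localForms.1 hγ).2

/-! ### Differential operators of order `m` and their values on forms of degree `m` -/

/-- The `i`-th partial derivative as an endomorphism. -/
noncomputable def derivOp (K : Type*) [Field K] (i : Fin 3) :
    Module.End K (MvPolynomial (Fin 3) K) :=
  ((pderiv (R := K) i : Derivation K (MvPolynomial (Fin 3) K) (MvPolynomial (Fin 3) K)) :
    Module.End K (MvPolynomial (Fin 3) K))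

theorem derivOp_apply (i : Fin 3) (g : MvPolynomial (Fin 3) K) : derivOp K i g = pderiv i g := rfl

theorem partialOp_eq (a : Fin 3 → ℕ) :
    partialOp K a = derivOp K 0 ^ a 0 * (derivOp K 1 ^ a 1 * derivOp K 2 ^ a 2) := by
  simp [partialOp, List.ofFn_succ, derivOp]

theorem derivOp_pow_monomial (i : Fin 3) (k : ℕ) (b : Fin 3 →₀ ℕ) (c : K) :
    (derivOp K i ^ k) (monomial b c) =
      monomial (b - Finsupp.single i k) (c * (b i).descFactorial k) := by
  induction k with
  | zero => simp
  | succ k ih =>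
    rw [pow_succ', Module.End.mul_apply, ih]
    rw [derivOp_apply, pderiv_monomial, tsub_tsub, ← Finsupp.single_add, Nat.descFactorial_succ,
      Finsupp.tsub_apply, Finsupp.single_eq_same, Nat.cast_mul]
    congr 1
    ring

theorem partialOp_monomial (a : Fin 3 → ℕ) (b : Fin 3 →₀ ℕ) (c : K) :
    partialOp K a (monomial b c) =
      monomial (b - Finsupp.single 2 (a 2) - Finsupp.single 1 (a 1) - Finsupp.single 0 (a 0))
        (c * ∏ i, ((b i).descFactorial (a i) : K)) := by
  rw [partialOp_eq, Module.End.mul_apply, Module.End.mul_apply, derivOp_pow_monomial,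
    derivOp_pow_monomial, derivOp_pow_monomial, Fin.prod_univ_three]
  congr 1
  simp
  ring

theorem partialOp_monomial_of_lt {a : Fin 3 → ℕ} {b : Fin 3 →₀ ℕ} {i : Fin 3} (h : b i < a i)
    (c : K) : partialOp K a (monomial b c) = 0 := by
  rw [partialOp_monomial, Finset.prod_eq_zero (Finset.mem_univ i), mul_zero, monomial_zero]
  rw [Nat.descFactorial_of_lt h, Nat.cast_zero]

theorem partialOp_monomial_self (b : Fin 3 →₀ ℕ) (c : K) :
    partialOp K b (monomial b c) = C (c * ∏ i, ((b i).factorial : K)) := by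
  rw [partialOp_monomial]
  have : b - Finsupp.single 2 (b 2) - Finsupp.single 1 (b 1) - Finsupp.single 0 (b 0) = 0 := by
    ext i
    fin_cases i <;> simp
  rw [this]
  simp only [Nat.descFactorial_self]
  rfl

/-- Of two distinct exponents of equal degree, each exceeds the other somewhere. The `∂^a` and the
monomials of the same degree are therefore dual up to factorials. -/
theorem partialOp_monomial_of_ne {a b : Fin 3 →₀ ℕ} (h : a.degree = b.degree) (hne : a ≠ b)
    (c : K) : partialOp K a (monomial b c) = 0 := by
  have : ∃ i, b i < a i := by
    by_contra! hle
    refine hne (Finsupp.ext fun i => ?_)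
    by_contra hi
    have : a.degree < b.degree := by
      rw [Finsupp.degree_eq_sum, Finsupp.degree_eq_sum]
      exact Finset.sum_lt_sum (fun i _ => hle i) ⟨i, Finset.mem_univ i, lt_of_le_of_ne (hle i) hi⟩
    omega
  obtain ⟨i, hi⟩ := this
  exact partialOp_monomial_of_lt hi c

theorem partialOp_mem_diffOps {a : Fin 3 → ℕ} {m : ℕ} (ha : ∑ i, a i = m) :
    partialOp K a ∈ diffOps K 3 m :=
  Submodule.subset_span ⟨a, ha, rfl⟩

noncomputable instance (m : ℕ) : Fintype {a : Fin 3 →₀ ℕ | a.degree = m} := Fintype.ofFinite _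

/-- The differential operator of order `m` with prescribed values on forms of degree `m`. -/
noncomputable def operatorOfValues (m : ℕ) (φ : Forms K m →ₗ[K] MvPolynomial (Fin 3) K) :
    Module.End K (MvPolynomial (Fin 3) K) :=
  ∑ a : {a : Fin 3 →₀ ℕ | a.degree = m},
    -- The factorials normalise `∂^a x^a = ∏ i, (a i)!` to one.
    (C (∏ i, ((a.1 i).factorial : K))⁻¹ * φ (formsBasis K m a)) • partialOp K a.1

theorem operatorOfValues_mem (m : ℕ) (φ : Forms K m →ₗ[K] MvPolynomial (Fin 3) K) :
    operatorOfValues m φ ∈ diffOps K 3 m :=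
  Submodule.sum_mem _ fun a _ => Submodule.smul_mem _ _ (partialOp_mem_diffOps (by
    rw [← Finsupp.degree_eq_sum]; exact a.2))

theorem prod_factorial_ne_zero [CharZero K] (b : Fin 3 →₀ ℕ) :
    ∏ i, ((b i).factorial : K) ≠ 0 :=
  Finset.prod_ne_zero_iff.2 fun _ _ => Nat.cast_ne_zero.2 (Nat.factorial_ne_zero _)

theorem operatorOfValues_comp_subtype [CharZero K] (m : ℕ)
    (φ : Forms K m →ₗ[K] MvPolynomial (Fin 3) K) :
    operatorOfValues m φ ∘ₗ (Forms K m).subtype = φ := by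
  refine (formsBasis K m).ext fun b => ?_
  rw [LinearMap.comp_apply, Submodule.subtype_apply, formsBasis_apply, operatorOfValues,
    LinearMap.sum_apply, Finset.sum_eq_single b]
  · rw [LinearMap.smul_apply, partialOp_monomial_self, smul_eq_mul, one_mul, mul_right_comm, ← C_mul,
      inv_mul_cancel₀ (prod_factorial_ne_zero _), C_1, one_mul]
  · intro a _ hab
    rw [LinearMap.smul_apply, partialOp_monomial_of_ne (a.2.trans b.2.symm)
      (fun h => hab (Subtype.ext h)), smul_zero]
  · simp

theorem operatorOfValues_of_mem [CharZero K] {m : ℕ} {θ : Module.End K (MvPolynomial (Fin 3) K)}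
    (hθ : θ ∈ diffOps K 3 m) : operatorOfValues m (θ ∘ₗ (Forms K m).subtype) = θ := by
  induction hθ using Submodule.span_induction with
  | mem θ h =>
    obtain ⟨a, ha, rfl⟩ := h
    let c : {a : Fin 3 →₀ ℕ | a.degree = m} :=
      ⟨Finsupp.equivFunOnFinite.symm a, by
        simp only [Set.mem_ofPred_eq, Finsupp.degree_eq_sum]; exact ha⟩
    have hc : partialOp K a = partialOp K c.1 := rfl
    rw [hc, operatorOfValues, Finset.sum_eq_single c]
    · rw [LinearMap.comp_apply, Submodule.subtype_apply, formsBasis_apply,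
        partialOp_monomial_self, one_mul, ← C_mul, inv_mul_cancel₀ (prod_factorial_ne_zero _),
        C_1, one_smul]
    · intro b _ hbc
      rw [LinearMap.comp_apply, Submodule.subtype_apply, formsBasis_apply,
        partialOp_monomial_of_ne (c.2.trans b.2.symm) (fun h => hbc (Subtype.ext h.symm)),
        mul_zero, zero_smul]
    · simp
  | zero => simp [operatorOfValues]
  | add θ η _ _ h₁ h₂ =>
    conv_rhs => rw [← h₁, ← h₂]
    simp [operatorOfValues, mul_add, add_smul, Finset.sum_add_distrib]
  | smul f θ _ h =>
    conv_rhs => rw [← h]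
    simp [operatorOfValues, Finset.smul_sum, mul_left_comm, mul_smul]

/-- Up to nonzero scalars, the coefficients of `θ` are its values on the monomials of degree `m`. -/
theorem dvd_apply_of_dvd_forms [CharZero K] {m : ℕ} {θ : Module.End K (MvPolynomial (Fin 3) K)}
    (hθ : θ ∈ diffOps K 3 m) {α : MvPolynomial (Fin 3) K} (h : ∀ g ∈ Forms K m, α ∣ θ g)
    (g : MvPolynomial (Fin 3) K) : α ∣ θ g := by
  rw [← operatorOfValues_of_mem hθ, operatorOfValues, LinearMap.sum_apply]
  refine Finset.dvd_sum fun a _ => ?_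
  rw [LinearMap.smul_apply, smul_eq_mul]
  exact Dvd.dvd.mul_right (Dvd.dvd.mul_left (h _ (formsBasis K m a).2) _) _

/-! ### Commutators and the criterion for preserving `Q S` -/

/-- The commutator of an operator with the multiplication by `f`. -/
noncomputable def commutator (θ : Module.End K (MvPolynomial (Fin 3) K))
    (f : MvPolynomial (Fin 3) K) : Module.End K (MvPolynomial (Fin 3) K) :=
  θ * LinearMap.mulLeft K f - LinearMap.mulLeft K f * θ

theorem commutator_apply (θ : Module.End K (MvPolynomial (Fin 3) K))
    (f g : MvPolynomial (Fin 3) K) : commutator θ f g = θ (f * g) - f * θ g := rfl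

theorem pow_mul_of_mul_eq_add_one {R : Type*} [Ring R] {D x : R} (h : D * x = x * D + 1) (n : ℕ) :
    D ^ n * x = x * D ^ n + n • D ^ (n - 1) := by
  induction n with
  | zero => simp
  | succ n ih =>
    rw [pow_succ', mul_assoc, ih, mul_add, ← mul_assoc, h, mul_smul_comm, add_mul, one_mul,
      mul_assoc, Nat.add_sub_cancel, add_assoc, succ_nsmul']
    rcases n with _ | n
    · simp
    · rw [Nat.add_sub_cancel, ← pow_succ' D n]

theorem derivOp_mul_same (i : Fin 3) :
    derivOp K i * LinearMap.mulLeft K (X i) = LinearMap.mulLeft K (X i) * derivOp K i + 1 := by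
  refine LinearMap.ext fun g => ?_
  rw [LinearMap.add_apply, Module.End.mul_apply, Module.End.mul_apply, LinearMap.mulLeft_apply,
    LinearMap.mulLeft_apply, derivOp_apply, derivOp_apply, Module.End.one_apply,
    Derivation.leibniz, pderiv_X_self, smul_eq_mul, smul_eq_mul, mul_one]

theorem derivOp_commute {i j : Fin 3} (h : i ≠ j) :
    Commute (derivOp K i) (LinearMap.mulLeft K (X j)) := by
  refine LinearMap.ext fun g => ?_
  rw [Module.End.mul_apply, Module.End.mul_apply, LinearMap.mulLeft_apply,
    LinearMap.mulLeft_apply, derivOp_apply, derivOp_apply,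
    Derivation.leibniz, pderiv_X_of_ne h.symm, smul_eq_mul, smul_zero, add_zero]

/-- The Weyl relation at index `i`, where the other two derivatives commute with `X i`. When `a i =
0` the truncated exponent is harmless, as the coefficient vanishes. -/
theorem commutator_partialOp (a : Fin 3 → ℕ) (i : Fin 3) :
    commutator (partialOp K a) (X i) = a i • partialOp K (Function.update a i (a i - 1)) := by
  rw [commutator, sub_eq_iff_eq_add', partialOp_eq, partialOp_eq]
  have hs := pow_mul_of_mul_eq_add_one (derivOp_mul_same (K := K) i) (a i)
  have hc : ∀ j, j ≠ i → derivOp K j ^ a j * LinearMap.mulLeft K (X i) =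
      LinearMap.mulLeft K (X i) * derivOp K j ^ a j := fun j hj =>
    (derivOp_commute hj).pow_left (a j)
  fin_cases i
  · simp only [Fin.zero_eta] at *
    rw [mul_assoc, mul_assoc, hc 2 (by decide), ← mul_assoc (derivOp K 1 ^ a 1), hc 1 (by decide),
      mul_assoc, ← mul_assoc, hs]
    simp [add_mul, mul_assoc, -nsmul_eq_mul]
  · simp only [Fin.mk_one] at *
    rw [mul_assoc, mul_assoc, hc 2 (by decide), ← mul_assoc (derivOp K 1 ^ a 1), hs, add_mul, mul_add,
      ← mul_assoc (derivOp K 0 ^ a 0), ← mul_assoc (derivOp K 0 ^ a 0), hc 0 (by decide)]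
    simp [mul_assoc, -nsmul_eq_mul]
  · simp only [Fin.reduceFinMk] at *
    rw [mul_assoc, mul_assoc, hs, mul_add, mul_add, ← mul_assoc (derivOp K 1 ^ a 1), hc 1 (by decide),
      mul_assoc, ← mul_assoc (derivOp K 0 ^ a 0), hc 0 (by decide)]
    simp [mul_assoc, -nsmul_eq_mul]

theorem commutator_X_mem {m : ℕ} {θ : Module.End K (MvPolynomial (Fin 3) K)}
    (hθ : θ ∈ diffOps K 3 (m + 1)) (i : Fin 3) : commutator θ (X i) ∈ diffOps K 3 m := by
  induction hθ using Submodule.span_induction with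
  | mem θ h =>
    obtain ⟨a, ha, rfl⟩ := h
    rw [commutator_partialOp]
    by_cases h0 : a i = 0
    · rw [h0, zero_smul]; exact Submodule.zero_mem _
    · refine nsmul_mem (partialOp_mem_diffOps ?_) _
      rw [Finset.sum_update_of_mem (Finset.mem_univ i)]
      have := Finset.add_sum_erase Finset.univ a (Finset.mem_univ i)
      rw [Finset.sdiff_singleton_eq_erase]
      omega
  | zero => simp [commutator]
  | add θ η _ _ h₁ h₂ =>
    have : commutator (θ + η) (X i) = commutator θ (X i) + commutator η (X i) := by
      simp only [commutator]; noncomm_ring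
    rw [this]
    exact Submodule.add_mem _ h₁ h₂
  | smul f θ _ h =>
    have : commutator (f • θ) (X i) = f • commutator θ (X i) := by
      refine LinearMap.ext fun g => ?_
      simp only [commutator_apply, LinearMap.smul_apply, smul_eq_mul]
      ring
    rw [this]
    exact Submodule.smul_mem _ _ h

theorem commutator_mem {m : ℕ} {θ : Module.End K (MvPolynomial (Fin 3) K)}
    (hθ : θ ∈ diffOps K 3 (m + 1)) {α : MvPolynomial (Fin 3) K} (hα : α.IsHomogeneous 1) :
    commutator θ α ∈ diffOps K 3 m := by
  have h : α ∈ homogeneousSubmodule (Fin 3) K 1 := hα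
  rw [homogeneousSubmodule_one_eq_span_X, Submodule.mem_span_range_iff_exists_fun] at h
  obtain ⟨c, rfl⟩ := h
  have : commutator θ (∑ i, c i • X i) = ∑ i, (C (c i) : MvPolynomial (Fin 3) K) • commutator θ (X i) := by
    refine LinearMap.ext fun g => ?_
    rw [commutator_apply, Finset.sum_mul, map_sum, Finset.sum_mul, ← Finset.sum_sub_distrib,
      LinearMap.sum_apply]
    refine Finset.sum_congr rfl fun i _ => ?_
    rw [LinearMap.smul_apply, commutator_apply, smul_mul_assoc, map_smul, smul_mul_assoc,
      smul_eq_mul, mul_sub, smul_eq_C_mul, smul_eq_C_mul]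
  rw [this]
  exact Submodule.sum_mem _ fun i _ => Submodule.smul_mem _ _ (commutator_X_mem hθ i)

theorem apply_eq_mul_of_mem_diffOps_zero {θ : Module.End K (MvPolynomial (Fin 3) K)}
    (hθ : θ ∈ diffOps K 3 0) (g : MvPolynomial (Fin 3) K) : θ g = g * θ 1 := by
  induction hθ using Submodule.span_induction with
  | mem θ h =>
    obtain ⟨a, ha, rfl⟩ := h
    have ha' : ∀ i, a i = 0 := by simpa using ha
    simp [partialOp_eq, ha']
  | zero => simp
  | add θ η _ _ h₁ h₂ => rw [LinearMap.add_apply, h₁, h₂, LinearMap.add_apply, mul_add]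
  | smul f θ _ h =>
    rw [LinearMap.smul_apply, LinearMap.smul_apply, h, smul_eq_mul, smul_eq_mul, mul_left_comm]

theorem apply_one_eq_zero {m : ℕ} {θ : Module.End K (MvPolynomial (Fin 3) K)}
    (hθ : θ ∈ diffOps K 3 (m + 1)) : θ 1 = 0 := by
  induction hθ using Submodule.span_induction with
  | mem θ h =>
    obtain ⟨a, ha, rfl⟩ := h
    obtain ⟨i, hi⟩ : ∃ i, a i ≠ 0 := by
      by_contra! h
      simp [h] at ha
    exact partialOp_monomial_of_lt (b := 0) (i := i) (by simpa using Nat.pos_of_ne_zero hi) 1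
  | zero => simp
  | add θ η _ _ h₁ h₂ => rw [LinearMap.add_apply, h₁, h₂, add_zero]
  | smul f θ _ h => rw [LinearMap.smul_apply, h, smul_zero]

/-- An operator whose values on a multiple `q S`, with `α` not dividing `q`, are divisible by `α`
has all its values divisible by `α`. -/
theorem dvd_apply_of_dvd_apply_mul {m : ℕ} {θ : Module.End K (MvPolynomial (Fin 3) K)}
    (hθ : θ ∈ diffOps K 3 m) {α q : MvPolynomial (Fin 3) K} (hα : Prime α) (hq : ¬ α ∣ q)
    (h : ∀ g, α ∣ θ (q * g)) (g : MvPolynomial (Fin 3) K) : α ∣ θ g := by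
  induction m generalizing θ g with
  | zero =>
    have h1 := h 1
    rw [apply_eq_mul_of_mem_diffOps_zero hθ, mul_one] at h1
    rw [apply_eq_mul_of_mem_diffOps_zero hθ]
    exact Dvd.dvd.mul_left ((hα.dvd_or_dvd h1).resolve_left hq) _
  | succ m ih =>
    -- Commutators with the variables satisfy the same hypothesis in order `m`. By induction they
    -- vanish modulo `α`, so `θ` is `S`-linear modulo `α`, and `θ 1 = 0` finishes.
    have hX : ∀ i g, α ∣ θ (X i * g) - X i * θ g := fun i g =>
      ih (commutator_X_mem hθ i) (fun g => by
        rw [commutator_apply, mul_left_comm]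
        exact dvd_sub (h _) (Dvd.dvd.mul_left (h _) _)) g
    have hf : ∀ f g, α ∣ θ (f * g) - f * θ g := by
      intro f
      induction f using MvPolynomial.induction_on with
      | C c =>
        intro g
        rw [← smul_eq_C_mul, map_smul, smul_eq_C_mul, sub_self]
        exact dvd_zero _
      | add p q hp hq =>
        intro g
        rw [add_mul, add_mul, map_add, add_sub_add_comm]
        exact dvd_add (hp g) (hq g)
      | mul_X p i hp =>
        intro g
        have : θ (p * X i * g) - p * X i * θ g =
            (θ (p * (X i * g)) - p * θ (X i * g)) + p * (θ (X i * g) - X i * θ g) := by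
          rw [mul_assoc p]; ring
        rw [this]
        exact dvd_add (hp _) (Dvd.dvd.mul_left (hX i g) _)
    have := hf g 1
    rwa [mul_one, apply_one_eq_zero hθ, mul_zero, sub_zero] at this

/-- The condition at one line can be tested on forms of degree `m`. -/
theorem dvd_apply_mul_of_forms [CharZero K] {m : ℕ} {θ : Module.End K (MvPolynomial (Fin 3) K)}
    (hθ : θ ∈ diffOps K 3 m) {α : MvPolynomial (Fin 3) K} (hα : α.IsHomogeneous 1)
    (h : ∀ g ∈ Forms K m, α ∣ g → α ∣ θ g) (g : MvPolynomial (Fin 3) K) : α ∣ θ (α * g) := by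
  cases m with
  | zero =>
    rw [apply_eq_mul_of_mem_diffOps_zero hθ, mul_assoc]
    exact dvd_mul_right _ _
  | succ m =>
    -- The commutator with `α` agrees with `g ↦ θ (α * g)` modulo `α` and has order one less. It is
    -- tested on forms `g` of degree `m`, for which `α * g` has degree `m + 1`.
    have h1 := dvd_apply_of_dvd_forms (commutator_mem hθ hα) (α := α) (fun g hg => by
      rw [commutator_apply]
      refine dvd_sub (h _ ?_ (dvd_mul_right _ _)) (dvd_mul_right _ _)
      have := hα.mul hg
      rwa [add_comm] at this) g
    rw [commutator_apply] at h1
    exact (dvd_sub_left (dvd_mul_right _ _)).1 h1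

/-- This separates the condition at one line from those at the others: modulo `α`, the commutator
with `α` vanishes on `q S`, hence everywhere. -/
theorem dvd_apply_mul_of_dvd_apply_mul_mul {m : ℕ} {θ : Module.End K (MvPolynomial (Fin 3) K)}
    (hθ : θ ∈ diffOps K 3 m) {α q : MvPolynomial (Fin 3) K} (hα : α.IsHomogeneous 1)
    (hα' : Prime α) (hq : ¬ α ∣ q)
    (h : ∀ g, α ∣ θ (α * q * g)) (g : MvPolynomial (Fin 3) K) : α ∣ θ (α * g) := by
  cases m with
  | zero =>
    rw [apply_eq_mul_of_mem_diffOps_zero hθ, mul_assoc]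
    exact dvd_mul_right _ _
  | succ m =>
    have h1 := dvd_apply_of_dvd_apply_mul (commutator_mem hθ hα) hα' hq (fun g => by
      rw [commutator_apply, ← mul_assoc]
      exact dvd_sub (h _) (dvd_mul_right _ _)) g
    rw [commutator_apply] at h1
    exact (dvd_sub_left (dvd_mul_right _ _)).1 h1

/-- `θ` preserves the ideal of `Q = ∏ α` iff its restriction to forms of degree `m` is
admissible. -/
theorem preserves_span_prod_iff [CharZero K] {m : ℕ} {θ : Module.End K (MvPolynomial (Fin 3) K)}
    (hθ : θ ∈ diffOps K 3 m) {A : Finset (MvPolynomial (Fin 3) K)} (hA : IsReducedForms A) :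
    (∀ g ∈ Ideal.span {∏ α ∈ A, α}, θ g ∈ Ideal.span {∏ α ∈ A, α}) ↔
      θ ∘ₗ (Forms K m).subtype ∈ admissible (Forms K m) A := by
  classical
  simp only [Ideal.mem_span_singleton]
  constructor
  · rintro h α hα ⟨g, hg⟩ ⟨u, hu⟩
    change g = α * u at hu
    subst hu
    refine dvd_apply_mul_of_dvd_apply_mul_mul hθ (hA.homog α hα) (hA.prime hα)
      (hA.not_dvd_prod (Finset.erase_subset α A) hα (Finset.notMem_erase _ _)) (fun g => ?_) u
    rw [Finset.mul_prod_erase A (fun α => α) hα]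
    exact (Finset.dvd_prod_of_mem _ hα).trans (h _ (dvd_mul_right _ _))
  · intro h g hg
    refine hA.prod_dvd fun α hα => ?_
    obtain ⟨u, rfl⟩ := (Finset.dvd_prod_of_mem (fun α => α) hα).trans hg
    exact dvd_apply_mul_of_forms hθ (hA.homog α hα) (fun g hg hd => h α hα ⟨g, hg⟩ hd) u

/-! ### Rank, and passage from admissible maps to operators -/

/-- The admissible maps lie between all `K`-linear maps `S_m → S` and the multiples of these by `∏
α`, which form a module of the same rank. -/
theorem finrank_admissible [CharZero K] {m : ℕ} {A : Finset (MvPolynomial (Fin 3) K)}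
    (hA : IsReducedForms A) :
    Module.finrank (MvPolynomial (Fin 3) K) (admissible (Forms K m) A) = (m + 2).choose m := by
  let e := (formsBasis K m).constr (MvPolynomial (Fin 3) K) (M' := MvPolynomial (Fin 3) K)
  have hfin : Module.Finite (MvPolynomial (Fin 3) K)
      (Forms K m →ₗ[K] MvPolynomial (Fin 3) K) := Module.Finite.equiv e
  have hrank : Module.finrank (MvPolynomial (Fin 3) K)
      (Forms K m →ₗ[K] MvPolynomial (Fin 3) K) = (m + 2).choose m := by
    rw [← e.finrank_eq, Module.finrank_fintype_fun_eq_card, ← Nat.card_eq_fintype_card,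
      card_degree_eq]
  rw [← hrank]
  refine le_antisymm (Submodule.finrank_le _) ?_
  let s : (Forms K m →ₗ[K] MvPolynomial (Fin 3) K) →ₗ[MvPolynomial (Fin 3) K]
      admissible (Forms K m) A :=
    (LinearMap.lsmul (MvPolynomial (Fin 3) K) (Forms K m →ₗ[K] MvPolynomial (Fin 3) K)
      (∏ α ∈ A, α)).codRestrict _ fun φ α hα g _ =>
        Dvd.dvd.mul_right (Finset.dvd_prod_of_mem (fun α => α) hα) (φ g)
  refine LinearMap.finrank_le_finrank_of_injective (f := s) fun φ ψ h => LinearMap.ext fun g => ?_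
  exact mul_left_cancel₀ hA.prod_ne_zero (DFunLike.congr_fun (congrArg Subtype.val h) g)

/-- Restriction to forms of degree `m` identifies the operators preserving the ideal of
`Q = ∏ α` with the admissible maps. -/
theorem nonempty_equiv_admissible [CharZero K] {m : ℕ} {A : Finset (MvPolynomial (Fin 3) K)}
    (hA : IsReducedForms A)
    {D : Submodule (MvPolynomial (Fin 3) K) (Module.End K (MvPolynomial (Fin 3) K))}
    (hD : ∀ θ, θ ∈ D ↔ θ ∈ diffOps K 3 m ∧
      ∀ g ∈ Ideal.span {∏ α ∈ A, α}, θ g ∈ Ideal.span {∏ α ∈ A, α}) :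
    Nonempty (admissible (Forms K m) A ≃ₗ[MvPolynomial (Fin 3) K] D) := by
  let r : D →ₗ[MvPolynomial (Fin 3) K] admissible (Forms K m) A :=
    { toFun := fun θ => ⟨θ.1 ∘ₗ (Forms K m).subtype,
        (preserves_span_prod_iff ((hD _).1 θ.2).1 hA).1 ((hD _).1 θ.2).2⟩
      map_add' := fun _ _ => rfl
      map_smul' := fun _ _ => rfl }
  have hr : Function.Bijective r := by
    constructor
    · intro θ η h
      have h' : θ.1 ∘ₗ (Forms K m).subtype = η.1 ∘ₗ (Forms K m).subtype := congrArg Subtype.val h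
      ext1
      rw [← operatorOfValues_of_mem ((hD _).1 θ.2).1, h', operatorOfValues_of_mem ((hD _).1 η.2).1]
    · intro φ
      have hmem := operatorOfValues_mem m φ.1
      refine ⟨⟨operatorOfValues m φ.1, (hD _).2 ⟨hmem, ?_⟩⟩, ?_⟩
      · rw [preserves_span_prod_iff hmem hA, operatorOfValues_comp_subtype]
        exact φ.2
      · exact Subtype.ext (operatorOfValues_comp_subtype m φ.1)
  exact ⟨(LinearEquiv.ofBijective r hr).symm⟩

theorem exists_generators_of_finrank_eq {R M : Type*} [CommRing R] [Nontrivial R] [AddCommGroup M]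
    [Module R M] {D : Submodule R M} {n : ℕ} (hfree : Module.Free R D) (hfin : Module.Finite R D)
    (hn : Module.finrank R D = n) :
    ∃ θ : Fin n → M, LinearIndependent R θ ∧ Submodule.span R (Set.range θ) = D := by
  let B := Module.finBasisOfFinrankEq R D hn
  refine ⟨fun i => B i, B.linearIndependent.map' D.subtype (Submodule.ker_subtype D), ?_⟩
  have : Set.range (fun i => (B i : M)) = D.subtype '' Set.range B := by
    rw [← Set.range_comp]; rfl
  rw [this, Submodule.span_image, B.span_eq, Submodule.map_top, Submodule.range_subtype]

theorem exists_operators_of_free [CharZero K] {m : ℕ} {A : Finset (MvPolynomial (Fin 3) K)}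
    (hA : IsReducedForms A)
    {D : Submodule (MvPolynomial (Fin 3) K) (Module.End K (MvPolynomial (Fin 3) K))}
    (hD : ∀ θ, θ ∈ D ↔ θ ∈ diffOps K 3 m ∧
      ∀ g ∈ Ideal.span {∏ α ∈ A, α}, θ g ∈ Ideal.span {∏ α ∈ A, α})
    (hfree : Module.Free (MvPolynomial (Fin 3) K) (admissible (Forms K m) A)) :
    ∃ θ : Fin ((m + 2).choose m) → Module.End K (MvPolynomial (Fin 3) K),
      LinearIndependent (MvPolynomial (Fin 3) K) θ ∧
        Submodule.span (MvPolynomial (Fin 3) K) (Set.range θ) = D := by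
  obtain ⟨e⟩ := nonempty_equiv_admissible hA hD
  have hrank := e.finrank_eq.symm.trans (finrank_admissible hA)
  have hfree' := Module.Free.of_equiv e
  exact exists_generators_of_finrank_eq hfree'
    -- Finite generation comes from the rank being positive, as an infinite rank would give
    -- `finrank` zero.
    (Module.finite_of_finrank_pos (hrank ▸ Nat.choose_pos (by omega))) hrank

/-! ### From hyperplanes to reduced sets of forms -/

section Geometry

variable {V : Type*} [AddCommGroup V] [Module K V]

theorem formToPoly_smul {l : ℕ} (b : Module.Basis (Fin l) K V) (s : K) (α : Module.Dual K V) :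
    formToPoly b (s • α) = s • formToPoly b α := by
  simp [formToPoly, Finset.smul_sum, smul_eq_C_mul, mul_assoc]

theorem formToPoly_add {l : ℕ} (b : Module.Basis (Fin l) K V) (α β : Module.Dual K V) :
    formToPoly b (α + β) = formToPoly b α + formToPoly b β := by
  simp [formToPoly, add_mul, Finset.sum_add_distrib]

theorem formToPoly_zero {l : ℕ} (b : Module.Basis (Fin l) K V) :
    formToPoly b (0 : Module.Dual K V) = 0 := by
  simp [formToPoly]

theorem isHomogeneous_formToPoly {l : ℕ} (b : Module.Basis (Fin l) K V) (α : Module.Dual K V) :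
    (formToPoly b α).IsHomogeneous 1 :=
  IsHomogeneous.sum _ _ _ fun _ _ => isHomogeneous_C_mul_X _ _

theorem formToPoly_injective {l : ℕ} (b : Module.Basis (Fin l) K V) :
    Function.Injective (formToPoly b) := by
  classical
  intro α β h
  refine b.ext fun i => ?_
  have := congrArg (eval (Pi.single i 1)) h
  simpa [formToPoly, Pi.single_apply] using this

open Classical in
/-- The defining forms of an arrangement. -/
noncomputable def definingForms {l : ℕ} (b : Module.Basis (Fin l) K V)
    (A : CentralArrangement K V) : Finset (MvPolynomial (Fin l) K) :=
  A.hyperplanes.image fun H => formToPoly b (linearForm H)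

theorem formToPoly_linearForm_ne_zero {l : ℕ} (b : Module.Basis (Fin l) K V) {H : Submodule K V}
    (hH : IsCoatom H) : formToPoly b (linearForm H) ≠ 0 := fun h => by
  have h0 : linearForm H = 0 := formToPoly_injective b (h.trans (formToPoly_zero b).symm)
  have := ker_linearForm hH
  rw [h0, LinearMap.ker_zero] at this
  exact hH.1 this.symm

theorem eq_of_formToPoly_dvd {l : ℕ} (b : Module.Basis (Fin l) K V) {H H' : Submodule K V}
    (hH : IsCoatom H) (hH' : IsCoatom H')
    (h : formToPoly b (linearForm H) ∣ formToPoly b (linearForm H')) : H = H' := by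
  obtain ⟨c, hc⟩ := exists_smul_of_dvd (isHomogeneous_formToPoly b _)
    (isHomogeneous_formToPoly b _) h
  have hc' : linearForm H' = c • linearForm H :=
    formToPoly_injective b (hc.trans (formToPoly_smul b c _).symm)
  have hle : H ≤ H' := by
    rw [← ker_linearForm hH, ← ker_linearForm hH', hc']
    intro v hv
    rw [LinearMap.mem_ker] at hv ⊢
    rw [LinearMap.smul_apply, hv, smul_zero]
  exact ((hH.le_iff.1 hle).resolve_left hH'.1).symm

theorem isReducedForms_definingForms {l : ℕ} (b : Module.Basis (Fin l) K V)
    (A : CentralArrangement K V) : IsReducedForms (definingForms b A) := by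
  classical
  refine ⟨fun α hα => ?_, fun α hα => ?_, fun α hα β hβ h => ?_⟩
  · obtain ⟨H, hH, rfl⟩ := Finset.mem_image.1 hα
    exact isHomogeneous_formToPoly b _
  · obtain ⟨H, hH, rfl⟩ := Finset.mem_image.1 hα
    exact formToPoly_linearForm_ne_zero b (A.isCoatom H hH)
  · obtain ⟨H, hH, rfl⟩ := Finset.mem_image.1 hα
    obtain ⟨H', hH', rfl⟩ := Finset.mem_image.1 hβ
    rw [eq_of_formToPoly_dvd b (A.isCoatom H hH) (A.isCoatom H' hH') h]

theorem definingPoly_eq_prod {l : ℕ} (b : Module.Basis (Fin l) K V) (A : CentralArrangement K V) :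
    definingPoly b A = ∏ α ∈ definingForms b A, α := by
  classical
  rw [definingForms, Finset.prod_image]
  · rfl
  · intro H hH H' hH' h
    exact eq_of_formToPoly_dvd b (A.isCoatom H hH) (A.isCoatom H' hH') (dvd_of_eq h)

theorem isMFree_of_free [CharZero K] (b : Module.Basis (Fin 3) K V) (A : CentralArrangement K V)
    {m : ℕ} (h : Module.Free (MvPolynomial (Fin 3) K)
      (admissible (Forms K m) (definingForms b A))) : IsMFree b A m :=
  exists_operators_of_free (isReducedForms_definingForms b A)
    (fun θ => by rw [← definingPoly_eq_prod]; rfl) h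

theorem isMFree_of_card_le [CharZero K] (b : Module.Basis (Fin 3) K V)
    (A : CentralArrangement K V) {m : ℕ} (h : A.hyperplanes.card ≤ m + 2) : IsMFree b A m := by
  classical
  exact isMFree_of_free b A (free_admissible_forms_of_card_le (isReducedForms_definingForms b A)
    (Finset.card_image_le.trans h))

/-- The linear forms vanishing at a nonzero vector of a three-dimensional space form a pencil. -/
theorem exists_pencil (b : Module.Basis (Fin 3) K V) {v : V} (hv : v ≠ 0) :
    ∃ α β : Module.Dual K V, LinearIndependent K ![α, β] ∧
      ∀ γ : Module.Dual K V, γ v = 0 → γ ∈ Submodule.span K {α, β} := by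
  have hfd : FiniteDimensional K V := Module.Finite.of_basis b
  -- The forms vanishing at `v` are the kernel of a nonzero functional on the three-dimensional dual
  -- space, so they have dimension two.
  have hne : Module.Dual.eval K V v ≠ 0 := fun h => hv ((Module.eval_apply_eq_zero_iff K v).1 h)
  have hrank := Module.Dual.finrank_ker_add_one_of_ne_zero hne
  rw [Subspace.dual_finrank_eq, Module.finrank_eq_card_basis b, Fintype.card_fin] at hrank
  have hmem : ∀ γ : Module.Dual K V, γ v = 0 → γ ∈ LinearMap.ker (Module.Dual.eval K V v) :=
    fun γ h => h
  generalize LinearMap.ker (Module.Dual.eval K V v) = W at hrank hmem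
  obtain ⟨θ, hli, hspan⟩ := exists_generators_of_finrank_eq (D := W) (n := 2)
    (Module.Free.of_divisionRing K W) inferInstance (by omega)
  have hθ : ![θ 0, θ 1] = θ := by
    funext i
    fin_cases i <;> rfl
  refine ⟨θ 0, θ 1, hθ ▸ hli, fun γ h => ?_⟩
  have := hspan ▸ hmem γ h
  rwa [← hθ, Matrix.range_cons, Matrix.range_cons, Matrix.range_empty, Set.union_empty,
      Set.singleton_union] at this

/-- A nonzero vector common to all hyperplanes places all defining forms in one pencil. -/
theorem isMFree_of_not_isEssential [CharZero K] (b : Module.Basis (Fin 3) K V)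
    (A : CentralArrangement K V) (h : ¬ A.IsEssential) (m : ℕ) : IsMFree b A m := by
  classical
  obtain ⟨v, hv, hv0⟩ := (Submodule.ne_bot_iff _).1 h
  obtain ⟨α, β, hli, hspan⟩ := exists_pencil b hv0
  have hli' : LinearIndependent K ![formToPoly b α, formToPoly b β] := by
    rw [LinearIndependent.pair_iff] at hli ⊢
    intro s t hst
    rw [← formToPoly_smul, ← formToPoly_smul, ← formToPoly_add, ← formToPoly_zero b] at hst
    exact hli s t (formToPoly_injective b hst)
  refine isMFree_of_free b A (free_admissible_forms_of_subset_pencil (isHomogeneous_formToPoly b _)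
    (isHomogeneous_formToPoly b _) hli' (isReducedForms_definingForms b A) (fun γ hγ => ?_) m)
  obtain ⟨H, hH, rfl⟩ := Finset.mem_image.1 hγ
  have hvH : v ∈ H := (Submodule.mem_sInf.1 hv) H hH
  rw [← ker_linearForm (A.isCoatom H hH)] at hvH
  obtain ⟨s, t, hst⟩ := Submodule.mem_span_pair.1 (hspan _ hvH)
  refine Submodule.mem_span_pair.2 ⟨s, t, ?_⟩
  rw [← hst, formToPoly_add, formToPoly_smul, formToPoly_smul]

end Geometry

end CentralArrangement

/-- For an arrangement `A` of `n` hyperplanes in a three-dimensional space over a field of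
characteristic zero: if `A` is essential then it is `m`-free for all `m ≥ n - 2`; if it is not
essential then it is `m`-free for all `m`; in particular `A` is `m`-free for all large `m`. -/
theorem mainTheorem2 {K V : Type*} [Field K] [CharZero K] [AddCommGroup V] [Module K V]
    (b : Module.Basis (Fin 3) K V) (A : CentralArrangement K V) :
    (A.IsEssential → ∀ m : ℕ, (A.hyperplanes.card : ℤ) - 2 ≤ m →
      CentralArrangement.IsMFree b A m) ∧
    (¬ A.IsEssential → ∀ m : ℕ, CentralArrangement.IsMFree b A m) ∧
    (∃ m₀ : ℕ, ∀ m : ℕ, m₀ ≤ m → CentralArrangement.IsMFree b A m) :=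
  ⟨fun _ _ hm => CentralArrangement.isMFree_of_card_le b A (by omega),
    fun h m => CentralArrangement.isMFree_of_not_isEssential b A h m,
    A.hyperplanes.card, fun _ hm => CentralArrangement.isMFree_of_card_le b A (by omega)⟩
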